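/- Let $\mathrm{Comb}(\mathbb{Z})$ be the graph with vertex set $\mathbb{Z}\times\mathbb{Z}$ in which $(x,n)$ and $(x,m)$ are adjacent whenever $|m-n|=1$, and $(x,0)$ and $(y,0)$ are adjacent whenever $|x-y|=1$. For a real number $\alpha$, let $\mathrm{Comb}(\mathbb{Z},\alpha)$ be the wedge comb with profile $f(x)=|x|^{\alpha}$ (with $0^{\alpha}:=0$ for $\alpha\neq 0$ and $0^{0}:=1$), that is, the subgraph of $\mathrm{Comb}(\mathbb{Z})$ induced on the vertices $(x,y)\in\mathbb{Z}^2$ with $0\le y\le f(x)$. For a graph $G$ let $P_{a,b}$ denote the law of a pair $(X_t,Y_t)_{t\ge 0}$ of independent discrete time simple random walks on $G$ with $X_0=a$, $Y_0=b$, and let $Z=|\{t\ge 0: X_t=Y_t\}|$ be the total number of collisions. The graph $G$ has the finite collision property if $P_{a,a}(Z<\infty)=1$ for every vertex $a$, and the infinite collision property if $P_{a,a}(Z=\infty)=1$ for every vertex $a$. (a) If $\alpha\le 1$, then $\mathrm{Comb}(\mathbb{Z},\alpha)$ has the infinite collision property. (b) If $\alpha>1$, then $\mathrm{Comb}(\mathbb{Z},\alpha)$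 has the finite collision property. -/

import Mathlib

open MeasureTheory ProbabilityTheory

namespace CombCollision

section Walk

variable {V : Type*} (G : SimpleGraph V) [G.LocallyFinite]

open Classical in
/-- One step of simple random walk: uniform on the neighbours of `x`.
(At an isolated vertex, which has no neighbour to jump to, the walk stays put.) -/
noncomputable def stepPMF (x : V) : PMF V :=
  if h : (G.neighborFinset x).Nonempty then PMF.uniformOfFinset (G.neighborFinset x) h
  else PMF.pure x

variable [MeasurableSpace V] [DiscreteMeasurableSpace V]

/-- The transition kernel of simple random walk on `G`. -/
noncomputable def stepKernel : Kernel V V where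
  toFun x := (stepPMF G x).toMeasure
  measurable' := Measurable.of_discrete

instance : IsMarkovKernel (stepKernel G) :=
  ⟨fun x => inferInstanceAs (IsProbabilityMeasure (stepPMF G x).toMeasure)⟩

/-- The same kernel, as a function of the trajectory up to time `n`: it only looks at the
position at time `n` (Markov property). -/
noncomputable def historyKernel (n : ℕ) : Kernel (Finset.Iic n → V) V :=
  (stepKernel G).comap (fun h => h ⟨n, Finset.mem_Iic.2 le_rfl⟩) (measurable_pi_apply _)

instance (n : ℕ) : IsMarkovKernel (historyKernel G n) :=
  inferInstanceAs (IsMarkovKernel (Kernel.comap _ _ _))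

/-- The law on `ℕ → V` of the discrete time simple random walk on `G` started at `a`. -/
noncomputable def walkLaw (a : V) : Measure (ℕ → V) :=
  Kernel.trajMeasure (X := fun _ => V) (Measure.dirac a) (historyKernel G)

/-- The law `P_{a,b}` of a pair `(X, Y)` of independent simple random walks on `G`
with `X 0 = a` and `Y 0 = b`. -/
noncomputable def pairLaw (a b : V) : Measure ((ℕ → V) × (ℕ → V)) :=
  (walkLaw G a).prod (walkLaw G b)

/-- The total number `Z` of collisions of two trajectories. -/
noncomputable def collisions (ω : (ℕ → V) × (ℕ → V)) : ℕ∞ :=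
  {t : ℕ | ω.1 t = ω.2 t}.encard

/-- `P_{a,a}(Z < ∞) = 1` for every vertex `a`. -/
def FiniteCollisionProperty : Prop :=
  ∀ a : V, ∀ᵐ ω ∂(pairLaw G a a), collisions ω < ⊤

/-- `P_{a,a}(Z = ∞) = 1` for every vertex `a`. -/
def InfiniteCollisionProperty : Prop :=
  ∀ a : V, ∀ᵐ ω ∂(pairLaw G a a), collisions ω = ⊤

end Walk

/-- The graph `Comb(ℤ)`. -/
def combZ : SimpleGraph (ℤ × ℤ) where
  Adj p q := (p.1 = q.1 ∧ |p.2 - q.2| = 1) ∨ (p.2 = 0 ∧ q.2 = 0 ∧ |p.1 - q.1| = 1)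
  symm := ⟨by
    rintro p q (⟨h, h'⟩ | ⟨h, h', h''⟩)
    · exact Or.inl ⟨h.symm, by rwa [abs_sub_comm]⟩
    · exact Or.inr ⟨h', h, by rwa [abs_sub_comm]⟩⟩
  loopless := ⟨by
    rintro p (⟨-, h⟩ | ⟨-, -, h⟩) <;> simp at h⟩

/-- The vertices `(x, y)` of `Comb(ℤ)` with `0 ≤ y ≤ f x`. -/
def wedgeVertices (f : ℤ → ℝ) : Set (ℤ × ℤ) :=
  {p | 0 ≤ p.2 ∧ (p.2 : ℝ) ≤ f p.1}

/-- The wedge comb `Comb(ℤ, f)` with profile `f`: the subgraph of `Comb(ℤ)` induced on the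
vertices `(x, y)` with `0 ≤ y ≤ f x`. -/
def wedgeComb (f : ℤ → ℝ) : SimpleGraph (wedgeVertices f) :=
  combZ.induce (wedgeVertices f)

theorem wedgeComb_neighborSet_finite (f : ℤ → ℝ) (v : wedgeVertices f) :
    ((wedgeComb f).neighborSet v).Finite := by
  have hbox : (Set.Icc (v.1.1 - 1) (v.1.1 + 1) ×ˢ Set.Icc (v.1.2 - 1) (v.1.2 + 1)).Finite :=
    (Set.finite_Icc _ _).prod (Set.finite_Icc _ _)
  refine (hbox.preimage (f := Subtype.val) Subtype.val_injective.injOn).subset ?_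
  rintro w (⟨h, h'⟩ | ⟨h, h', h''⟩)
  · simp only [Function.Embedding.subtype_apply] at h h'
    rcases abs_eq (zero_le_one' ℤ) |>.1 h' with h' | h' <;>
      simp only [Set.mem_preimage, Set.mem_prod, Set.mem_Icc] <;> omega
  · simp only [Function.Embedding.subtype_apply] at h h' h''
    rcases abs_eq (zero_le_one' ℤ) |>.1 h'' with h'' | h'' <;>
      simp only [Set.mem_preimage, Set.mem_prod, Set.mem_Icc] <;> omega

noncomputable instance (f : ℤ → ℝ) : (wedgeComb f).LocallyFinite :=
  fun v => (wedgeComb_neighborSet_finite f v).fintype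

/-- The profile `x ↦ |x| ^ α`, where `0 ^ α = 0` for `α ≠ 0` and `0 ^ 0 = 1`. -/
noncomputable def powerProfile (α : ℝ) (x : ℤ) : ℝ := |(x : ℝ)| ^ α

end CombCollision

/-!
The law of the pair of walks enters only through `stayProb`, the probability that the pair
satisfies a constraint at each of finitely many times, given by first-step recursion
(`pairLaw_forall_lt`). Everything else is potential theory for the transition operator `avg` and
for its product `pairAvg`. The comb is bipartite, and walks from a common vertex keep equal
parities; this makes a function that is subharmonic off the diagonal in each variable subharmonic
for the pair (`sub_le_pairAvg_of_lap`).

*Case `α ≤ 1`.* The Green function of the part `|x| < r` of the comb is explicit (`boxPotential`).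
Teeth over `|x| ≤ r` have length at most `max r 1`, so on the diagonal this function is at most
`3r`, while at a fixed pair of vertices it is of order `r`. By the maximum principle the walks
collide before leaving the box with probability at least the ratio of the two
(`avoidProb_le_of_inBox`). Letting `r → ∞`, walks started at any two vertices of equal parity
avoid each other with probability at most `5 / 6`; since this holds from the positions at any
later time as well, they almost surely collide (`avoidProb_eq_zero`), and do so after every time.

*Case `1 < α`.* Put `β = min α 2`. After `s ^ (2 + β)` steps the walk has spread over `s` teeth up
to height `s ^ β`. A Nash type argument, comparing values on the backbone with averages over the
teeth and controlling the difference by the energy, which is the decrement of the return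
probabilities, shows that the probability of a collision on the backbone at that time is at most of order
`1 / s ^ (1 + 2 * β)` (`sum_sq_heatPair_le`). As a power of time this is summable because `β > 1`.
Teeth are cut into dyadic boxes. The expected number of collisions at a vertex of a tooth is at
most of the order of the one at its bottom (`occupation_vtx_le`), and a collision in a box at
scale `ρ` is followed on average by at least of the order of `ρ` further ones nearby, by
comparison with the Green function of a segment (`one_sub_stayProb_le_gain`). Hence each box of a
tooth sees a collision with probability of the order of the occupation at the bottom
(`one_sub_stayProb_le`). There are only logarithmically many boxes in a tooth, so the sum over all
boxes converges (`tsum_size_mul_tsum_heat_sq_ne_top`), and the Borel–Cantelli lemma gives finitely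
many collisions.
-/

namespace CombCollision

/-! ### Transition operators and the Markov property -/

section General

variable {V : Type*} (G : SimpleGraph V) [G.LocallyFinite]

/-- The average of `g` over the neighbours of `x`, that is, the transition operator of simple
random walk on real functions. -/
noncomputable def avg (g : V → ℝ) (x : V) : ℝ :=
  (∑ y ∈ G.neighborFinset x, g y) / G.degree x

/-- The transition operator of two independent simple random walks. -/
noncomputable def pairAvg (g : V → V → ℝ) (x y : V) : ℝ :=
  avg G (fun x' => avg G (g x') y) x

open Classical in
/-- The probability that two independent walks started at `x` and `y` satisfy the constraint `S t`
at every time `t < N`, computed by first-step recursion. -/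
noncomputable def stayProb : ℕ → (ℕ → V → V → Prop) → V → V → ℝ
  | 0, _ => fun _ _ => 1
  | N + 1, S => fun x y =>
      if S 0 x y then pairAvg G (stayProb N (fun t => S (t + 1))) x y else 0

variable {G}

theorem avg_nonneg {g : V → ℝ} {x : V} (hg : ∀ y, 0 ≤ g y) : 0 ≤ avg G g x :=
  div_nonneg (Finset.sum_nonneg fun y _ => hg y) (Nat.cast_nonneg _)

theorem avg_mono_of_adj {g h : V → ℝ} {x : V} (hgh : ∀ y, G.Adj x y → g y ≤ h y) :
    avg G g x ≤ avg G h x :=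
  div_le_div_of_nonneg_right
    (Finset.sum_le_sum fun y hy => hgh y ((G.mem_neighborFinset x y).1 hy)) (Nat.cast_nonneg _)

theorem avg_mono {g h : V → ℝ} {x : V} (hgh : ∀ y, g y ≤ h y) : avg G g x ≤ avg G h x :=
  avg_mono_of_adj fun y _ => hgh y

theorem avg_congr_of_adj {g h : V → ℝ} {x : V} (hgh : ∀ y, G.Adj x y → g y = h y) :
    avg G g x = avg G h x :=
  le_antisymm (avg_mono_of_adj fun y hy => (hgh y hy).le)
    (avg_mono_of_adj fun y hy => (hgh y hy).ge)

theorem avg_add (g h : V → ℝ) (x : V) : avg G (fun y => g y + h y) x = avg G g x + avg G h x := by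
  simp only [avg, Finset.sum_add_distrib, add_div]

theorem avg_sub (g h : V → ℝ) (x : V) : avg G (fun y => g y - h y) x = avg G g x - avg G h x := by
  simp only [avg, Finset.sum_sub_distrib, sub_div]

theorem avg_const_mul (c : ℝ) (g : V → ℝ) (x : V) :
    avg G (fun y => c * g y) x = c * avg G g x := by
  simp only [avg, ← Finset.mul_sum, mul_div_assoc]

theorem avg_mul_const (c : ℝ) (g : V → ℝ) (x : V) :
    avg G (fun y => g y * c) x = avg G g x * c := by
  simp only [avg, ← Finset.sum_mul, div_mul_eq_mul_div]

theorem avg_sum {ι : Type*} (s : Finset ι) (g : ι → V → ℝ) (x : V) :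
    avg G (fun y => ∑ i ∈ s, g i y) x = ∑ i ∈ s, avg G (g i) x := by
  simp only [avg, Finset.sum_comm (t := s), Finset.sum_div]

theorem avg_const (hG : ∀ x, 0 < G.degree x) (c : ℝ) (x : V) : avg G (fun _ => c) x = c := by
  have : (G.degree x : ℝ) ≠ 0 := by exact_mod_cast (hG x).ne'
  rw [avg, Finset.sum_const, SimpleGraph.card_neighborFinset_eq_degree, nsmul_eq_mul]
  field_simp

theorem pairAvg_nonneg {g : V → V → ℝ} {x y : V} (hg : ∀ x y, 0 ≤ g x y) : 0 ≤ pairAvg G g x y :=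
  avg_nonneg fun _ => avg_nonneg fun _ => hg _ _

theorem pairAvg_mono_of_adj {g h : V → V → ℝ} {x y : V}
    (hgh : ∀ x' y', G.Adj x x' → G.Adj y y' → g x' y' ≤ h x' y') :
    pairAvg G g x y ≤ pairAvg G h x y :=
  avg_mono_of_adj fun _ hx => avg_mono_of_adj fun _ hy => hgh _ _ hx hy

theorem pairAvg_mono {g h : V → V → ℝ} {x y : V} (hgh : ∀ x' y', g x' y' ≤ h x' y') :
    pairAvg G g x y ≤ pairAvg G h x y :=
  pairAvg_mono_of_adj fun _ _ _ _ => hgh _ _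

theorem pairAvg_const (hG : ∀ x, 0 < G.degree x) (c : ℝ) (x y : V) :
    pairAvg G (fun _ _ => c) x y = c := by
  simp only [pairAvg, avg_const hG]

theorem pairAvg_add (g h : V → V → ℝ) (x y : V) :
    pairAvg G (fun x y => g x y + h x y) x y = pairAvg G g x y + pairAvg G h x y := by
  simp only [pairAvg, avg_add]

theorem pairAvg_sub (g h : V → V → ℝ) (x y : V) :
    pairAvg G (fun x y => g x y - h x y) x y = pairAvg G g x y - pairAvg G h x y := by
  simp only [pairAvg, avg_sub]

theorem pairAvg_const_mul (c : ℝ) (g : V → V → ℝ) (x y : V) :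
    pairAvg G (fun x y => c * g x y) x y = c * pairAvg G g x y := by
  simp only [pairAvg, avg_const_mul]

theorem pairAvg_mul (g h : V → ℝ) (x y : V) :
    pairAvg G (fun x y => g x * h y) x y = avg G g x * avg G h y := by
  simp only [pairAvg, avg_const_mul, avg_mul_const]

theorem stayProb_succ_of {N : ℕ} {S : ℕ → V → V → Prop} {x y : V} (h : S 0 x y) :
    stayProb G (N + 1) S x y = pairAvg G (stayProb G N fun t => S (t + 1)) x y := if_pos h

theorem stayProb_succ_of_not {N : ℕ} {S : ℕ → V → V → Prop} {x y : V} (h : ¬ S 0 x y) :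
    stayProb G (N + 1) S x y = 0 := if_neg h

theorem stayProb_nonneg (N : ℕ) (S : ℕ → V → V → Prop) (x y : V) : 0 ≤ stayProb G N S x y := by
  induction N generalizing S x y with
  | zero => simp [stayProb]
  | succ N ih =>
    simp only [stayProb]
    split_ifs
    · exact pairAvg_nonneg fun _ _ => ih _ _ _
    · exact le_rfl

theorem stayProb_le_one (hG : ∀ x, 0 < G.degree x) (N : ℕ) (S : ℕ → V → V → Prop) (x y : V) :
    stayProb G N S x y ≤ 1 := by
  induction N generalizing S x y with
  | zero => simp [stayProb]
  | succ N ih =>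
    simp only [stayProb]
    split_ifs
    · exact (pairAvg_mono fun _ _ => ih _ _ _).trans_eq (pairAvg_const hG 1 x y)
    · exact zero_le_one

theorem stayProb_succ_le (hG : ∀ x, 0 < G.degree x) (N : ℕ) (S : ℕ → V → V → Prop) (x y : V) :
    stayProb G (N + 1) S x y ≤ stayProb G N S x y := by
  induction N generalizing S x y with
  | zero => exact stayProb_le_one hG 1 S x y
  | succ N ih =>
    by_cases h : S 0 x y
    · rw [stayProb_succ_of h, stayProb_succ_of h]
      exact pairAvg_mono fun _ _ => ih _ _ _
    · rw [stayProb_succ_of_not h, stayProb_succ_of_not h]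

end General

section Markov

variable {V : Type*} {G : SimpleGraph V} [G.LocallyFinite]
  [MeasurableSpace V] [DiscreteMeasurableSpace V]

theorem lintegral_stepKernel (hG : ∀ x, 0 < G.degree x) (g : V → ℝ) (hg : ∀ y, 0 ≤ g y) (x : V) :
    ∫⁻ y, ENNReal.ofReal (g y) ∂(stepKernel G x) = ENNReal.ofReal (avg G g x) := by
  classical
  have hne : (G.neighborFinset x).Nonempty := by
    rw [← Finset.card_pos, SimpleGraph.card_neighborFinset_eq_degree]; exact hG x
  have hd : (0 : ℝ) < G.degree x := by exact_mod_cast hG x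
  have hk : stepKernel G x = ∑ y ∈ G.neighborFinset x,
      ((G.degree x : ENNReal)⁻¹) • Measure.dirac y := by
    change (stepPMF G x).toMeasure = _
    ext s hs
    rw [stepPMF, dif_pos hne, PMF.toMeasure_uniformOfFinset_apply _ _ hs]
    simp only [Measure.coe_finsetSum, Finset.sum_apply, Measure.smul_apply, smul_eq_mul,
      Measure.dirac_apply' _ hs, Set.indicator_apply, Pi.one_apply, mul_ite, mul_one, mul_zero,
      ← Finset.sum_filter, Finset.sum_const, nsmul_eq_mul,
      SimpleGraph.card_neighborFinset_eq_degree, div_eq_mul_inv]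
  rw [hk, lintegral_finsetSum_measure, avg, ENNReal.ofReal_div_of_pos hd,
    ENNReal.ofReal_sum_of_nonneg fun y _ => hg y]
  simp only [lintegral_smul_measure, lintegral_dirac, smul_eq_mul, ← Finset.mul_sum,
    ENNReal.ofReal_natCast]
  rw [mul_comm, div_eq_mul_inv]

instance (a : V) : IsProbabilityMeasure (walkLaw G a) := by
  unfold walkLaw; infer_instance

/-- The Markov property: given the trajectory up to time `n`, the next position is averaged
with the transition operator. -/
theorem lintegral_walkLaw_succ (hG : ∀ x, 0 < G.degree x) (a : V) (n : ℕ)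
    (Φ : (Finset.Iic n → V) → ENNReal) (hΦ : Measurable Φ) (g : V → ℝ) (hg : ∀ y, 0 ≤ g y) :
    ∫⁻ ω, Φ (Preorder.frestrictLe n ω) * ENNReal.ofReal (g (ω (n + 1))) ∂(walkLaw G a) =
      ∫⁻ ω, Φ (Preorder.frestrictLe n ω) * ENNReal.ofReal (avg G g (ω n)) ∂(walkLaw G a) := by
  have hmg : Measurable fun y => ENNReal.ofReal (g y) := Measurable.of_discrete
  have key := Kernel.map_frestrictLe_trajMeasure_compProd_eq_map_trajMeasure
    (X := fun _ => V) (μ₀ := Measure.dirac a) (κ := historyKernel G) (a := n)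
  have hF : Measurable fun p : (Finset.Iic n → V) × V => Φ p.1 * ENNReal.ofReal (g p.2) :=
    (hΦ.comp measurable_fst).mul (hmg.comp measurable_snd)
  have h1 := congrArg (fun μ => ∫⁻ p, Φ p.1 * ENNReal.ofReal (g p.2) ∂μ) key
  rw [Measure.lintegral_compProd hF, lintegral_map hF (by fun_prop)] at h1
  rw [walkLaw, ← h1, lintegral_map _ (by fun_prop)]
  · refine lintegral_congr fun ω => ?_
    dsimp only
    rw [lintegral_const_mul _ hmg]
    congr 1
    exact lintegral_stepKernel hG g hg (ω n)
  · exact hF.lintegral_kernel_prod_right'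

theorem lintegral_walkLaw_zero (a : V) (g : V → ENNReal) :
    ∫⁻ ω, g (ω 0) ∂(walkLaw G a) = g a := by
  have hg : Measurable g := Measurable.of_discrete
  have hF : Measurable fun h : Finset.Iic 0 → V => g (h ⟨0, Finset.mem_Iic.2 le_rfl⟩) := by
    fun_prop
  have h0 : ∀ x : Finset.Iic 0 → V, ∫⁻ ω, g (ω 0) ∂(Kernel.traj (X := fun _ => V)
      (historyKernel G) 0 x) =
      g (x ⟨0, Finset.mem_Iic.2 le_rfl⟩) := by
    intro x
    have h := Kernel.traj_map_frestrictLe_apply (X := fun _ => V) (κ := historyKernel G) 0 0 x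
    rw [Kernel.partialTraj_self, Kernel.id_apply] at h
    have h2 := congrArg (fun μ => ∫⁻ p : Finset.Iic 0 → V,
      g (p ⟨0, Finset.mem_Iic.2 le_rfl⟩) ∂μ) h
    rw [lintegral_map hF (by fun_prop), lintegral_dirac' _ hF] at h2
    exact h2
  have hg0 : Measurable fun ω : ℕ → V => g (ω 0) := hg.comp (measurable_pi_apply 0)
  rw [walkLaw, Kernel.trajMeasure, Measure.lintegral_bind (Kernel.aemeasurable _)
    hg0.aemeasurable]
  simp only [h0]
  rw [lintegral_map hF (by fun_prop), lintegral_dirac]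
  rfl

section Pair

variable [Countable V]

instance (a b : V) : IsProbabilityMeasure (pairLaw G a b) := by
  unfold pairLaw; infer_instance

/-- The Markov property of the pair: by Fubini, each walk is averaged in turn. -/
theorem lintegral_pairLaw_succ (hG : ∀ x, 0 < G.degree x) (a b : V) (n : ℕ)
    (Φ : (Finset.Iic n → V) × (Finset.Iic n → V) → ENNReal) (hΦ : Measurable Φ)
    (g : V → V → ℝ) (hg : ∀ x y, 0 ≤ g x y) :
    ∫⁻ ω, Φ (Preorder.frestrictLe n ω.1, Preorder.frestrictLe n ω.2) *
        ENNReal.ofReal (g (ω.1 (n + 1)) (ω.2 (n + 1))) ∂(pairLaw G a b) =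
      ∫⁻ ω, Φ (Preorder.frestrictLe n ω.1, Preorder.frestrictLe n ω.2) *
        ENNReal.ofReal (pairAvg G g (ω.1 n) (ω.2 n)) ∂(pairLaw G a b) := by
  have hm (h : V → V → ℝ) (i j : ℕ) : Measurable fun ω : (ℕ → V) × (ℕ → V) =>
      Φ (Preorder.frestrictLe n ω.1, Preorder.frestrictLe n ω.2) *
        ENNReal.ofReal (h (ω.1 i) (ω.2 j)) := by
    have h1 : Measurable fun p : V × V => ENNReal.ofReal (h p.1 p.2) := Measurable.of_discrete
    have h2 : Measurable fun ω : (ℕ → V) × (ℕ → V) => (ω.1 i, ω.2 j) := by fun_prop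
    exact (hΦ.comp (by fun_prop)).mul (h1.comp h2)
  rw [pairLaw, lintegral_prod _ (hm g _ _).aemeasurable]
  have h1 (ω : ℕ → V) := lintegral_walkLaw_succ hG b n
    (fun h => Φ (Preorder.frestrictLe n ω, h)) (by fun_prop) (g (ω (n + 1))) (hg _)
  simp only [h1]
  rw [← lintegral_prod (fun ω : (ℕ → V) × (ℕ → V) =>
      Φ (Preorder.frestrictLe n ω.1, Preorder.frestrictLe n ω.2) *
        ENNReal.ofReal (avg G (g (ω.1 (n + 1))) (ω.2 n)))
      (hm (fun x y => avg G (g x) y) _ _).aemeasurable,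
    lintegral_prod_symm _ (hm (fun x y => avg G (g x) y) _ _).aemeasurable,
    lintegral_prod_symm _ (hm (pairAvg G g) _ _).aemeasurable]
  refine lintegral_congr fun ω => ?_
  exact lintegral_walkLaw_succ hG a n
    (fun h => Φ (h, Preorder.frestrictLe n ω)) (by fun_prop) (fun x => avg G (g x) (ω n))
    (fun x => avg_nonneg fun _ => hg _ _)

/-- `stayProb` is the probability it is meant to be. -/
theorem pairLaw_forall_lt (hG : ∀ x, 0 < G.degree x) (a b : V) (S : ℕ → V → V → Prop) (N : ℕ) :
    pairLaw G a b {ω | ∀ t < N, S t (ω.1 t) (ω.2 t)} = ENNReal.ofReal (stayProb G N S a b) := by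
  classical
  have hmS (t : ℕ) : MeasurableSet {ω : (ℕ → V) × (ℕ → V) | S t (ω.1 t) (ω.2 t)} := by
    have h2 : Measurable fun ω : (ℕ → V) × (ℕ → V) => (ω.1 t, ω.2 t) := by fun_prop
    exact h2 (MeasurableSet.of_discrete (s := {p : V × V | S t p.1 p.2}))
  have hmC (j : ℕ) : MeasurableSet {ω : (ℕ → V) × (ℕ → V) | ∀ t < j, S t (ω.1 t) (ω.2 t)} := by
    simp only [Set.ofPred_forall]
    exact MeasurableSet.iInter fun t => MeasurableSet.iInter fun _ => hmS t
  -- the expected conditional probability of success given the first `j` positions does not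
  -- depend on `j`
  have key : ∀ j N : ℕ, ∫⁻ ω,
      ({ω : (ℕ → V) × (ℕ → V) | ∀ t < j, S t (ω.1 t) (ω.2 t)}.indicator 1 ω)
      * ENNReal.ofReal (stayProb G N (fun t => S (t + j)) (ω.1 j) (ω.2 j)) ∂(pairLaw G a b) =
      ENNReal.ofReal (stayProb G (N + j) S a b) := by
    intro j
    induction j with
    | zero =>
      intro N
      simp only [not_lt_zero, false_imp_iff, implies_true, Set.ofPred_true, Set.indicator_univ,
        Pi.one_apply, one_mul, add_zero]
      have h1 : Measurable fun p : V × V => ENNReal.ofReal (stayProb G N S p.1 p.2) :=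
        Measurable.of_discrete
      have h2 : Measurable fun ω : (ℕ → V) × (ℕ → V) => (ω.1 0, ω.2 0) := by fun_prop
      have h4 := h1.comp h2
      simp only [Function.comp_def] at h4
      rw [pairLaw, lintegral_prod _ h4.aemeasurable]
      have h3 (ω : ℕ → V) := lintegral_walkLaw_zero (G := G) b
        fun y => ENNReal.ofReal (stayProb G N S (ω 0) y)
      simp only [h3]
      exact lintegral_walkLaw_zero a fun x => ENNReal.ofReal (stayProb G N S x b)
    | succ j ih =>
      intro N
      have hD : MeasurableSet {h : (Finset.Iic j → V) × (Finset.Iic j → V) |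
          ∀ t : Finset.Iic j, S t (h.1 t) (h.2 t)} := by
        simp only [Set.ofPred_forall]
        refine MeasurableSet.iInter fun t => ?_
        have h2 : Measurable fun h : (Finset.Iic j → V) × (Finset.Iic j → V) => (h.1 t, h.2 t) := by
          fun_prop
        exact h2 (MeasurableSet.of_discrete (s := {p : V × V | S t p.1 p.2}))
      have hstep := lintegral_pairLaw_succ hG a b j _ (measurable_one.indicator hD)
        (stayProb G N (fun t => S (t + (j + 1)))) (fun _ _ => stayProb_nonneg _ _ _ _)
      have hind (ω : (ℕ → V) × (ℕ → V)) :
          {h : (Finset.Iic j → V) × (Finset.Iic j → V) |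
            ∀ t : Finset.Iic j, S t (h.1 t) (h.2 t)}.indicator
              (1 : (Finset.Iic j → V) × (Finset.Iic j → V) → ENNReal)
              (Preorder.frestrictLe j ω.1, Preorder.frestrictLe j ω.2) =
          {ω : (ℕ → V) × (ℕ → V) | ∀ t < j + 1, S t (ω.1 t) (ω.2 t)}.indicator 1 ω := by
        simp only [Set.indicator_apply, Set.mem_ofPred_eq, Pi.one_apply, Subtype.forall,
          Finset.mem_Iic, Nat.lt_succ_iff]
        rfl
      simp only [hind] at hstep
      rw [hstep, show N + (j + 1) = N + 1 + j by ring, ← ih (N + 1)]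
      refine lintegral_congr fun ω => ?_
      by_cases h : ∀ t < j, S t (ω.1 t) (ω.2 t)
      · by_cases h' : S j (ω.1 j) (ω.2 j)
        · have h1 : ω ∈ {ω : (ℕ → V) × (ℕ → V) | ∀ t < j + 1, S t (ω.1 t) (ω.2 t)} := by
            intro t ht
            rcases Nat.lt_succ_iff_lt_or_eq.1 ht with ht | rfl
            exacts [h t ht, h']
          rw [Set.indicator_of_mem h1, Set.indicator_of_mem (by exact h),
            stayProb_succ_of (by simpa using h')]
          simp only [add_right_comm _ 1 j, add_assoc]
        · have h1 : ω ∉ {ω : (ℕ → V) × (ℕ → V) | ∀ t < j + 1, S t (ω.1 t) (ω.2 t)} :=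
            fun h1 => h' (h1 j j.lt_succ_self)
          rw [Set.indicator_of_notMem h1, stayProb_succ_of_not (by simpa using h')]
          simp
      · have h1 : ω ∉ {ω : (ℕ → V) × (ℕ → V) | ∀ t < j + 1, S t (ω.1 t) (ω.2 t)} :=
          fun h1 => h fun t ht => h1 t (ht.trans j.lt_succ_self)
        rw [Set.indicator_of_notMem h1, Set.indicator_of_notMem (by exact h), zero_mul, zero_mul]
  have h := key N 0
  simp only [stayProb, ENNReal.ofReal_one, mul_one, zero_add] at h
  rw [← h, lintegral_indicator_one (hmC N)]

end Pair

end Markov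

/-! ### The geometry of the wedge comb -/

section Laplacian

variable {V : Type*} (G : SimpleGraph V) [G.LocallyFinite]

/-- The graph Laplacian of `g`, not normalised by the degree. -/
noncomputable def lap (g : V → ℝ) (x : V) : ℝ := ∑ y ∈ G.neighborFinset x, (g y - g x)

variable {G}

theorem lap_eq (hG : ∀ x, 0 < G.degree x) (g : V → ℝ) (x : V) :
    lap G g x = G.degree x * (avg G g x - g x) := by
  have : (G.degree x : ℝ) ≠ 0 := by exact_mod_cast (hG x).ne'
  rw [lap, Finset.sum_sub_distrib, Finset.sum_const, SimpleGraph.card_neighborFinset_eq_degree,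
    nsmul_eq_mul, avg]
  field_simp

theorem avg_sub_ge_of_lap (hG : ∀ x, 0 < G.degree x) {g : V → ℝ} {x : V} {c : ℝ} (hc : 0 ≤ c)
    (h : -c ≤ lap G g x) : g x - c ≤ avg G g x := by
  have hd : (1 : ℝ) ≤ G.degree x := by exact_mod_cast hG x
  rw [lap_eq hG] at h
  by_contra! hlt
  nlinarith

end Laplacian

section Geometry

variable (α : ℝ)

/-- The vertex type of the wedge comb with profile `|x| ^ α`. -/
abbrev Wedge : Type := wedgeVertices (powerProfile α)

/-- The wedge comb with profile `|x| ^ α`. -/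
noncomputable abbrev wedge : SimpleGraph (Wedge α) := wedgeComb (powerProfile α)

/-- The length of the tooth at `x`. -/
noncomputable def height (x : ℤ) : ℕ := ⌊powerProfile α x⌋₊

theorem powerProfile_nonneg (x : ℤ) : 0 ≤ powerProfile α x := Real.rpow_nonneg (abs_nonneg _) _

theorem mem_wedgeVertices_iff (p : ℤ × ℤ) :
    p ∈ wedgeVertices (powerProfile α) ↔ 0 ≤ p.2 ∧ p.2 ≤ height α p.1 := by
  change 0 ≤ p.2 ∧ (p.2 : ℝ) ≤ powerProfile α p.1 ↔ _
  refine and_congr_right fun h => ?_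
  rw [height, ← Int.toNat_le, Nat.le_floor_iff (powerProfile_nonneg α _)]
  have : ((p.2.toNat : ℤ) : ℝ) = (p.2 : ℝ) := by rw [Int.toNat_of_nonneg h]
  rw [← this, Int.cast_natCast]

/-- The vertex at height `y` of the tooth at `x`, where heights beyond the tip are moved to
the tip. With this convention the Laplacian has one formula for all heights `y ≥ 1`. -/
noncomputable def vtx (x : ℤ) (y : ℕ) : Wedge α :=
  ⟨(x, (min y (height α x) : ℕ)), (mem_wedgeVertices_iff α _).2 ⟨by positivity, by simp⟩⟩

variable {α}

@[simp] theorem vtx_fst (x : ℤ) (y : ℕ) : (vtx α x y).1.1 = x := rfl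

theorem vtx_snd {x : ℤ} {y : ℕ} (h : y ≤ height α x) : (vtx α x y).1.2 = y := by
  simp [vtx, h]

@[simp] theorem vtx_snd_zero (x : ℤ) : (vtx α x 0).1.2 = 0 := by simp [vtx]

theorem vtx_of_le {x : ℤ} {y : ℕ} (h : height α x ≤ y) : vtx α x y = vtx α x (height α x) := by
  simp [vtx, h]

theorem exists_eq_vtx (v : Wedge α) : ∃ x y, y ≤ height α x ∧ v = vtx α x y := by
  obtain ⟨⟨x, y⟩, h⟩ := v
  obtain ⟨h0, h1⟩ := (mem_wedgeVertices_iff α _).1 h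
  simp only at h0 h1
  refine ⟨x, y.toNat, by omega, Subtype.ext (Prod.ext rfl ?_)⟩
  rw [vtx_snd (by omega)]
  exact (Int.toNat_of_nonneg h0).symm

theorem vtx_inj {x x' : ℤ} {y y' : ℕ} (h : y ≤ height α x) (h' : y' ≤ height α x') :
    vtx α x y = vtx α x' y' ↔ x = x' ∧ y = y' := by
  refine ⟨fun e => ?_, by rintro ⟨rfl, rfl⟩; rfl⟩
  have e1 := congrArg (fun v : Wedge α => v.1.1) e
  have e2 := congrArg (fun v : Wedge α => v.1.2) e
  simp only [vtx_fst, vtx_snd h, vtx_snd h'] at e1 e2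
  exact ⟨e1, by exact_mod_cast e2⟩

theorem wedge_adj_iff (v w : Wedge α) : (wedge α).Adj v w ↔
    (v.1.1 = w.1.1 ∧ |v.1.2 - w.1.2| = 1) ∨ (v.1.2 = 0 ∧ w.1.2 = 0 ∧ |v.1.1 - w.1.1| = 1) :=
  Iff.rfl

theorem neighborFinset_vtx_zero [DecidableEq (Wedge α)] (x : ℤ) :
    (wedge α).neighborFinset (vtx α x 0) =
      if height α x = 0 then {vtx α (x - 1) 0, vtx α (x + 1) 0}
      else {vtx α (x - 1) 0, vtx α (x + 1) 0, vtx α x 1} := by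
  ext w
  obtain ⟨a, b, hb, rfl⟩ := exists_eq_vtx w
  rw [SimpleGraph.mem_neighborFinset, wedge_adj_iff, vtx_snd hb]
  split_ifs with h
  · simp only [Finset.mem_insert, Finset.mem_singleton, vtx_inj hb (Nat.zero_le _), vtx_fst,
      vtx_snd_zero]
    rw [abs_eq (zero_le_one' ℤ), abs_eq (zero_le_one' ℤ)]
    constructor
    · rintro (⟨rfl, h1⟩ | ⟨-, h1, h2⟩)
      · omega
      · omega
    · rintro (⟨rfl, rfl⟩ | ⟨rfl, rfl⟩) <;> simp
  · have h1 : 1 ≤ height α x := by omega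
    simp only [Finset.mem_insert, Finset.mem_singleton, vtx_inj hb (Nat.zero_le _), vtx_fst,
      vtx_inj hb h1, vtx_snd_zero]
    rw [abs_eq (zero_le_one' ℤ), abs_eq (zero_le_one' ℤ)]
    constructor
    · rintro (⟨rfl, h1⟩ | ⟨-, h1, h2⟩) <;> omega
    · rintro (⟨rfl, rfl⟩ | ⟨rfl, rfl⟩ | ⟨rfl, rfl⟩) <;> simp

theorem neighborFinset_vtx_succ [DecidableEq (Wedge α)] {x : ℤ} {y : ℕ} (hy : y + 1 ≤ height α x) :
    (wedge α).neighborFinset (vtx α x (y + 1)) =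
      if height α x = y + 1 then {vtx α x y} else {vtx α x y, vtx α x (y + 2)} := by
  ext w
  obtain ⟨a, b, hb, rfl⟩ := exists_eq_vtx w
  have hy' : y ≤ height α x := by omega
  rw [SimpleGraph.mem_neighborFinset, wedge_adj_iff, vtx_snd hb, vtx_snd hy]
  split_ifs with h
  · simp only [Finset.mem_singleton, vtx_inj hb hy', vtx_fst]
    rw [abs_eq (zero_le_one' ℤ), abs_eq (zero_le_one' ℤ)]
    constructor
    · rintro (⟨rfl, h1⟩ | ⟨h0, h1, h2⟩) <;> push_cast at * <;> omega
    · rintro ⟨rfl, rfl⟩; push_cast; omega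
  · have h1 : y + 2 ≤ height α x := by omega
    simp only [Finset.mem_insert, Finset.mem_singleton, vtx_inj hb hy', vtx_inj hb h1, vtx_fst]
    rw [abs_eq (zero_le_one' ℤ), abs_eq (zero_le_one' ℤ)]
    constructor
    · rintro (⟨rfl, h1⟩ | ⟨h0, h1, h2⟩) <;> push_cast at * <;> omega
    · rintro (⟨rfl, rfl⟩ | ⟨rfl, rfl⟩)
      · push_cast; omega
      · push_cast; omega

theorem lap_vtx_zero (g : Wedge α → ℝ) (x : ℤ) : lap (wedge α) g (vtx α x 0) =
    (g (vtx α (x - 1) 0) - g (vtx α x 0)) + (g (vtx α (x + 1) 0) - g (vtx α x 0)) +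
      (g (vtx α x 1) - g (vtx α x 0)) := by
  classical
  have h1 : vtx α (x - 1) 0 ≠ vtx α (x + 1) 0 := by
    rw [Ne, vtx_inj (Nat.zero_le _) (Nat.zero_le _)]; omega
  rw [lap, neighborFinset_vtx_zero]
  split_ifs with h
  · rw [Finset.sum_pair h1, vtx_of_le (y := 1) (by omega), h]; ring
  · have h2 : vtx α (x - 1) 0 ≠ vtx α x 1 := by
      rw [Ne, vtx_inj (Nat.zero_le _) (by omega)]; omega
    have h3 : vtx α (x + 1) 0 ≠ vtx α x 1 := by
      rw [Ne, vtx_inj (Nat.zero_le _) (by omega)]; omega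
    rw [Finset.sum_insert (by simp [h1, h2]), Finset.sum_pair h3]; ring

theorem lap_vtx_succ (g : Wedge α → ℝ) {x : ℤ} {y : ℕ} (hy : y + 1 ≤ height α x) :
    lap (wedge α) g (vtx α x (y + 1)) =
      (g (vtx α x y) - g (vtx α x (y + 1))) + (g (vtx α x (y + 2)) - g (vtx α x (y + 1))) := by
  classical
  rw [lap, neighborFinset_vtx_succ hy]
  split_ifs with h
  · rw [Finset.sum_singleton, vtx_of_le (y := y + 2) (by omega), h]; ring
  · rw [Finset.sum_pair]
    rw [Ne, vtx_inj (by omega) (by omega)]; omega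

theorem degree_pos (v : Wedge α) : 0 < (wedge α).degree v := by
  classical
  rw [← SimpleGraph.card_neighborFinset_eq_degree, Finset.card_pos]
  obtain ⟨x, y, hy, rfl⟩ := exists_eq_vtx v
  cases y with
  | zero =>
    rw [neighborFinset_vtx_zero]; split_ifs <;> simp
  | succ y =>
    rw [neighborFinset_vtx_succ hy]; split_ifs <;> simp

theorem degree_le_three (v : Wedge α) : (wedge α).degree v ≤ 3 := by
  classical
  rw [← SimpleGraph.card_neighborFinset_eq_degree]
  obtain ⟨x, y, hy, rfl⟩ := exists_eq_vtx v
  cases y with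
  | zero =>
    rw [neighborFinset_vtx_zero]
    split_ifs
    · exact Finset.card_le_two.trans (by norm_num)
    · exact Finset.card_le_three
  | succ y =>
    rw [neighborFinset_vtx_succ hy]
    split_ifs
    · simp
    · exact Finset.card_le_two.trans (by norm_num)

theorem adj_vtx_right (x : ℤ) : (wedge α).Adj (vtx α x 0) (vtx α (x + 1) 0) := by
  simp [wedge_adj_iff]

theorem adj_vtx_up {x : ℤ} {y : ℕ} (hy : y + 1 ≤ height α x) :
    (wedge α).Adj (vtx α x y) (vtx α x (y + 1)) := by
  rw [wedge_adj_iff, vtx_snd hy, vtx_snd (by omega)]; simp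

/-- The parity of a vertex; the comb is bipartite with respect to it. -/
def parity (v : Wedge α) : ZMod 2 := ((v.1.1 + v.1.2 : ℤ) : ZMod 2)

theorem parity_of_adj {v w : Wedge α} (h : (wedge α).Adj v w) : parity w = parity v + 1 := by
  have key : ∃ k : ℤ, w.1.1 + w.1.2 = v.1.1 + v.1.2 + 1 + 2 * k := by
    rw [wedge_adj_iff] at h
    have h' : (w.1.1 + w.1.2) % 2 = (v.1.1 + v.1.2 + 1) % 2 := by
      rcases h with ⟨h1, h2⟩ | ⟨h0, h1, h2⟩
      · rcases abs_eq (zero_le_one' ℤ) |>.1 h2 with h2 | h2 <;> omega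
      · rcases abs_eq (zero_le_one' ℤ) |>.1 h2 with h2 | h2 <;> omega
    exact ⟨((w.1.1 + w.1.2) - (v.1.1 + v.1.2 + 1)) / 2, by omega⟩
  obtain ⟨k, hk⟩ := key
  rw [parity, parity, hk]
  push_cast
  rw [show (2 : ZMod 2) = 0 from rfl]
  ring

end Geometry

section Potential

variable {α : ℝ}

open Classical in
/-- If `H` is, in each variable, subharmonic up to a mass `c` on the diagonal, then it is so for
the pair of walks, as long as the two walks have the same parity: a diagonal contribution picked
up by moving only one of the walks has the wrong parity. -/
theorem sub_le_pairAvg_of_lap {H : Wedge α → Wedge α → ℝ} {c : ℝ} (hc : 0 ≤ c) {A : Wedge α → Prop}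
    (hsymm : ∀ z w, H z w = H w z)
    (hH : ∀ z w, -(if z = w ∧ A z then c else 0) ≤ lap (wedge α) (H z) w)
    {z w : Wedge α} (hzw : parity z = parity w) :
    H z w - (if z = w ∧ A z then c else 0) ≤ pairAvg (wedge α) H z w := by
  have h0 (z w : Wedge α) : (0 : ℝ) ≤ if z = w ∧ A z then c else 0 := by split_ifs <;> simp [hc]
  have h1 (z w : Wedge α) : H z w - (if z = w ∧ A z then c else 0) ≤ avg (wedge α) (H z) w :=
    avg_sub_ge_of_lap degree_pos (h0 z w) (hH z w)
  have h2 : H z w - (if z = w ∧ A z then c else 0) ≤ avg (wedge α) (fun z' => H z' w) z := by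
    have := h1 w z
    have e : (if w = z ∧ A w then c else 0) = if z = w ∧ A z then c else 0 := by
      by_cases h : z = w
      · subst h; rfl
      · simp [h, Ne.symm h]
    rw [hsymm w z, e] at this
    have e' : H w = fun z' => H z' w := funext fun z' => hsymm w z'
    rwa [e'] at this
  refine h2.trans (avg_mono_of_adj fun z' hz' => ?_)
  have hne : z' ≠ w := by
    rintro rfl
    have := parity_of_adj hz'
    rw [hzw] at this
    simp at this
  simpa [hne] using h1 z' w

end Potential

/-! ### Infinitely many collisions when `α ≤ 1` -/

section Limit

variable {V : Type*} {G : SimpleGraph V} [G.LocallyFinite]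

theorem tendsto_avg {ι : Type*} {l : Filter ι} {g : ι → V → ℝ} {h : V → ℝ}
    (hg : ∀ y, Filter.Tendsto (fun i => g i y) l (nhds (h y))) (x : V) :
    Filter.Tendsto (fun i => avg G (g i) x) l (nhds (avg G h x)) :=
  (tendsto_finsetSum _ fun y _ => hg y).div_const _

theorem tendsto_pairAvg {ι : Type*} {l : Filter ι} {g : ι → V → V → ℝ} {h : V → V → ℝ}
    (hg : ∀ x y, Filter.Tendsto (fun i => g i x y) l (nhds (h x y))) (x y : V) :
    Filter.Tendsto (fun i => pairAvg G (g i) x y) l (nhds (pairAvg G h x y)) :=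
  tendsto_avg (fun x' => tendsto_avg (fun y' => hg x' y') y) x

variable (G) in
/-- The probability that two independent walks started at `x` and `y` never collide. -/
noncomputable def avoidProb (x y : V) : ℝ := ⨅ N, stayProb G N (fun _ x y => x ≠ y) x y

theorem avoidProb_le (x y : V) (N : ℕ) : avoidProb G x y ≤ stayProb G N (fun _ x y => x ≠ y) x y :=
  ciInf_le ⟨0, by rintro _ ⟨N, rfl⟩; exact stayProb_nonneg _ _ _ _⟩ N

theorem avoidProb_nonneg (x y : V) : 0 ≤ avoidProb G x y :=
  le_ciInf fun _ => stayProb_nonneg _ _ _ _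

theorem tendsto_avoidProb (hG : ∀ x, 0 < G.degree x) (x y : V) :
    Filter.Tendsto (fun N => stayProb G N (fun _ x y => x ≠ y) x y) Filter.atTop
      (nhds (avoidProb G x y)) :=
  tendsto_atTop_ciInf (antitone_nat_of_succ_le fun N => stayProb_succ_le hG N _ x y)
    ⟨0, by rintro _ ⟨N, rfl⟩; exact stayProb_nonneg _ _ _ _⟩

theorem avoidProb_self (x : V) : avoidProb G x x ≤ 0 :=
  (avoidProb_le x x 1).trans_eq (stayProb_succ_of_not (by simp))

theorem avoidProb_le_pairAvg (hG : ∀ x, 0 < G.degree x) {x y : V} (h : x ≠ y) :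
    avoidProb G x y ≤ pairAvg G (avoidProb G) x y :=
  ge_of_tendsto' (tendsto_pairAvg (fun x y => tendsto_avoidProb hG x y) x y) fun N =>
    (avoidProb_le x y (N + 1)).trans_eq (stayProb_succ_of h)

end Limit

section Recurrence

variable {α : ℝ}

/-- The profile at `0` takes the value `1` when `α = 0`, whence the maximum with `1`. -/
theorem height_le (hα : α ≤ 1) (x : ℤ) : (height α x : ℤ) ≤ max |x| 1 := by
  have h : powerProfile α x ≤ ((max |x| 1 : ℤ) : ℝ) := by
    rw [powerProfile]
    push_cast
    by_cases hx : x = 0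
    · subst hx
      by_cases h0 : α = 0
      · simp [h0]
      · simp [Real.zero_rpow h0]
    · have h1 : (1 : ℝ) ≤ |(x : ℝ)| := by exact_mod_cast Int.one_le_abs hx
      exact (Real.rpow_le_rpow_of_exponent_le h1 hα).trans (by simp)
  have h2 : ((height α x : ℤ) : ℝ) ≤ ((max |x| 1 : ℤ) : ℝ) := by
    rw [Int.cast_natCast]
    exact (Nat.floor_le (powerProfile_nonneg α x)).trans h
  exact_mod_cast h2

/-- Minus the distance of the backbone positions, plus twice the common height of two vertices of
the same tooth: a fundamental solution of the Laplacian in each variable. -/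
def treePotential (z w : Wedge α) : ℤ :=
  -|z.1.1 - w.1.1| + if z.1.1 = w.1.1 then 2 * min z.1.2 w.1.2 else 0

theorem treePotential_comm (z w : Wedge α) : treePotential z w = treePotential w z := by
  simp only [treePotential, abs_sub_comm z.1.1, eq_comm (a := z.1.1), min_comm z.1.2]

open Classical in
theorem lap_treePotential (z w : Wedge α) :
    -(if z = w then (2 : ℝ) else 0) ≤
      lap (wedge α) (fun w => (treePotential z w : ℝ)) w := by
  obtain ⟨k, y, hy, rfl⟩ := exists_eq_vtx z
  obtain ⟨l, v, hv, rfl⟩ := exists_eq_vtx w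
  simp only [vtx_inj hy hv]
  cases v with
  | zero =>
    rw [lap_vtx_zero]
    by_cases h : k = l ∧ y = 0
    · obtain ⟨rfl, rfl⟩ := h
      rw [if_pos ⟨rfl, rfl⟩]
      norm_cast
      simp only [treePotential, vtx_fst, vtx_snd_zero]
      simp [vtx]
    · rw [if_neg h]
      norm_cast
      simp only [treePotential, vtx, min_eq_left hy, min_eq_left hv, zero_min]
      rcases eq_or_ne k l with rfl | hkl
      · simp only [true_and] at h
        simp only [if_true, if_neg (show k ≠ k - 1 by omega), if_neg (show k ≠ k + 1 by omega),
          abs_eq_max_neg]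
        push_cast
        omega
      · simp only [if_neg hkl, abs_eq_max_neg]
        split_ifs <;> push_cast <;> omega
  | succ v =>
    have hv' : v ≤ height α l := by omega
    rw [lap_vtx_succ _ hv]
    by_cases h : k = l ∧ y = v + 1
    · obtain ⟨rfl, rfl⟩ := h
      rw [if_pos ⟨rfl, rfl⟩]
      norm_cast
      simp only [treePotential, vtx, min_eq_left hy, min_eq_left hv']
      simp only [sub_self, abs_zero, if_true]
      push_cast
      omega
    · rw [if_neg h]
      norm_cast
      simp only [treePotential, vtx, min_eq_left hy, min_eq_left hv, min_eq_left hv']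
      rcases eq_or_ne k l with rfl | hkl
      · simp only [true_and] at h
        simp only [if_true]
        push_cast
        omega
      · simp only [if_neg hkl]
        omega

/-- The Dirichlet potential of the part `|x| < r` of the comb: the bilinear correction, which is
harmonic in each variable, makes `treePotential` vanish when one of the vertices is `(±r, 0)`. -/
noncomputable def boxPotential (r : ℕ) (z w : Wedge α) : ℝ :=
  r + treePotential z w - z.1.1 * w.1.1 / r

theorem boxPotential_comm (r : ℕ) (z w : Wedge α) : boxPotential r z w = boxPotential r w z := by
  rw [boxPotential, boxPotential, treePotential_comm, mul_comm]

open Classical in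
theorem lap_boxPotential (r : ℕ) (z w : Wedge α) :
    -(if z = w then (2 : ℝ) else 0) ≤ lap (wedge α) (boxPotential r z) w := by
  have h : lap (wedge α) (boxPotential r z) w =
      lap (wedge α) (fun w => (treePotential z w : ℝ)) w := by
    obtain ⟨l, v, hv, rfl⟩ := exists_eq_vtx w
    cases v with
    | zero =>
      rw [lap_vtx_zero, lap_vtx_zero]
      simp only [boxPotential, vtx_fst]
      push_cast
      ring
    | succ v =>
      rw [lap_vtx_succ _ hv, lap_vtx_succ _ hv]
      simp only [boxPotential, vtx_fst]
      ring
  rw [h]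
  exact lap_treePotential z w

theorem boxPotential_eq_zero {r : ℕ} (hr : 0 < r) {z w : Wedge α} (hz : |z.1.1| = r)
    (hz' : z.1.2 = 0) (hw : |w.1.1| ≤ r) : boxPotential r z w = 0 := by
  have hw2 : 0 ≤ w.1.2 := w.2.1
  have hr' : (r : ℝ) ≠ 0 := by exact_mod_cast hr.ne'
  have ht : treePotential z w = -|z.1.1 - w.1.1| := by
    rw [treePotential, hz', min_eq_left hw2]; simp
  rw [boxPotential, ht]
  rcases (abs_eq (by positivity)).1 hz with h | h
  · have h3 : |z.1.1 - w.1.1| = r - w.1.1 := by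
      rw [h, abs_of_nonneg]; linarith [le_abs_self w.1.1]
    rw [h3, h]; push_cast; field_simp; ring
  · have h3 : |z.1.1 - w.1.1| = r + w.1.1 := by
      rw [h, abs_of_nonpos]
      · ring
      · linarith [neg_abs_le w.1.1]
    rw [h3, h]; push_cast; field_simp; ring

theorem boxPotential_self_le (hα : α ≤ 1) {r : ℕ} (hr : 0 < r) {z : Wedge α} (hz : |z.1.1| ≤ r) :
    boxPotential r z z ≤ 3 * r := by
  have h1 : z.1.2 ≤ r :=
    (((mem_wedgeVertices_iff α _).1 z.2).2.trans (height_le hα _)).trans (by omega)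
  have h1' : (z.1.2 : ℝ) ≤ r := by exact_mod_cast h1
  have h2 : (0 : ℝ) ≤ z.1.1 * z.1.1 / r := div_nonneg (mul_self_nonneg _) (Nat.cast_nonneg _)
  rw [boxPotential, treePotential]
  simp only [sub_self, abs_zero, if_true, min_self]
  push_cast
  linarith

/-- A function growing in the direction that leads down the teeth and then to the right. -/
noncomputable def driftFunction (z : Wedge α) : ℝ := 4 ^ (z.1.1 - z.1.2)

theorem driftFunction_pos (z : Wedge α) : 0 < driftFunction z := zpow_pos (by norm_num) _

theorem driftFunction_lt_avg (z : Wedge α) : driftFunction z < avg (wedge α) driftFunction z := by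
  have h : ∃ z', (wedge α).Adj z z' ∧ driftFunction z' = 4 * driftFunction z := by
    have h4 (a b : ℤ) (h : a = b + 1) : (4 : ℝ) ^ a = 4 * 4 ^ b := by
      rw [h, zpow_add_one₀ (by norm_num), mul_comm]
    obtain ⟨k, y, hy, rfl⟩ := exists_eq_vtx z
    cases y with
    | zero =>
      refine ⟨_, adj_vtx_right k, h4 _ _ ?_⟩
      simp
    | succ y =>
      refine ⟨_, (adj_vtx_up hy).symm, h4 _ _ ?_⟩
      rw [vtx_snd hy, vtx_snd (by omega)]
      simp only [vtx_fst]; push_cast; ring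
  obtain ⟨z', hadj, hz'⟩ := h
  have hd : (0 : ℝ) < (wedge α).degree z := by exact_mod_cast degree_pos z
  have hd3 : ((wedge α).degree z : ℝ) ≤ 3 := by exact_mod_cast degree_le_three z
  have h1 : driftFunction z' ≤ ∑ y ∈ (wedge α).neighborFinset z, driftFunction y :=
    Finset.single_le_sum (f := driftFunction) (fun y _ => (driftFunction_pos y).le)
      (((wedge α).mem_neighborFinset z z').2 hadj)
  rw [avg, lt_div_iff₀ hd]
  have := driftFunction_pos z
  nlinarith

/-- The part `|x| < r` of the comb, together with the two vertices `(±r, 0)` that end it. -/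
def InBox (r : ℕ) (z : Wedge α) : Prop := |z.1.1| ≤ r ∧ (|z.1.1| = r → z.1.2 = 0)

theorem finite_inBox (r : ℕ) : {z : Wedge α | InBox r z}.Finite := by
  classical
  refine (((Finset.Icc (-r : ℤ) r).biUnion fun x =>
    (Finset.range (height α x + 1)).image (vtx α x)).finite_toSet).subset ?_
  rintro z ⟨hz, -⟩
  obtain ⟨k, y, hy, rfl⟩ := exists_eq_vtx z
  simp only [Finset.coe_biUnion, Set.mem_iUnion]
  rw [vtx_fst, abs_le] at hz
  exact ⟨k, by simpa using hz, by
    simp only [Finset.coe_image, Finset.coe_range]; exact ⟨y, by simpa using by omega, rfl⟩⟩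

theorem inBox_of_adj {r : ℕ} {z z' : Wedge α} (hz : |z.1.1| < r) (h : (wedge α).Adj z z') :
    InBox r z' := by
  rw [InBox]
  rw [wedge_adj_iff] at h
  rcases h with ⟨h1, -⟩ | ⟨-, h1, h2⟩
  · rw [← h1]; exact ⟨hz.le, fun h => absurd h hz.ne⟩
  · refine ⟨?_, fun _ => h1⟩
    simp only [abs_eq_max_neg] at *
    omega

/-- Before leaving the box, the walks collide with probability at least the ratio of the Dirichlet
potential to its largest value on the diagonal (maximum principle). -/
theorem avoidProb_le_of_inBox (hα : α ≤ 1) {r : ℕ} (hr : 0 < r) {z w : Wedge α}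
    (hz : InBox r z) (hw : InBox r w) (hzw : parity z = parity w) :
    avoidProb (wedge α) z w ≤ 1 - boxPotential r z w / (3 * r) := by
  classical
  have hr' : (0 : ℝ) < 3 * r := by positivity
  set θ : Wedge α → Wedge α → ℝ := fun z w =>
    1 / (3 * r) * boxPotential r z w + avoidProb (wedge α) z w - 1 with hθ
  suffices h : θ z w ≤ 0 by
    simp only [hθ] at h; rw [div_eq_inv_mul, ← one_div]; linarith
  by_contra! hpos
  have hM : (0 : ℝ) < 4 ^ (r : ℤ) := by positivity
  -- a strictly subharmonic perturbation, too small to matter at `(z, w)`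
  set ε : ℝ := θ z w / (2 * 4 ^ (r : ℤ)) with hε
  have hε0 : 0 < ε := by positivity
  have hεθ : ε * 4 ^ (r : ℤ) < θ z w := by
    rw [hε]; field_simp; linarith
  set D : Set (Wedge α × Wedge α) :=
    {p | InBox r p.1 ∧ InBox r p.2 ∧ parity p.1 = parity p.2} with hD
  have hDf : D.Finite := ((finite_inBox r).prod (finite_inBox r)).subset
    fun p hp => ⟨hp.1, hp.2.1⟩
  obtain ⟨⟨a, b⟩, ⟨ha, hb, hab⟩, hmax⟩ := Set.exists_max_image D
    (fun p => θ p.1 p.2 + ε * driftFunction p.1) hDf ⟨(z, w), hz, hw, hzw⟩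
  simp only at ha hb hab hmax
  have hbig : ε * 4 ^ (r : ℤ) < θ a b + ε * driftFunction a := by
    have h1 := hmax (z, w) ⟨hz, hw, hzw⟩
    have h2 := mul_pos hε0 (driftFunction_pos z)
    simp only at h1
    linarith
  have hdrift : ε * driftFunction a ≤ ε * 4 ^ (r : ℤ) := by
    refine mul_le_mul_of_nonneg_left (zpow_le_zpow_right₀ (by norm_num) ?_) hε0.le
    have : 0 ≤ a.1.2 := a.2.1
    linarith [le_abs_self a.1.1, ha.1]
  have hθab : 0 < θ a b := by linarith
  have hle1 : avoidProb (wedge α) a b ≤ 1 :=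
    (avoidProb_le a b 0).trans (stayProb_le_one degree_pos _ _ _ _)
  have hne : a ≠ b := by
    rintro rfl
    have h1 : 1 / (3 * r) * boxPotential r a a ≤ 1 := by
      rw [one_div, ← div_eq_inv_mul, div_le_one hr']
      exact boxPotential_self_le hα hr ha.1
    have h2 := avoidProb_self (G := wedge α) a
    simp only [hθ] at hθab
    linarith
  have hza : |a.1.1| < r := by
    refine lt_of_le_of_ne ha.1 fun h => ?_
    simp only [hθ, boxPotential_eq_zero hr h (ha.2 h) hb.1] at hθab
    linarith
  have hzb : |b.1.1| < r := by
    refine lt_of_le_of_ne hb.1 fun h => ?_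
    simp only [hθ, boxPotential_comm r a b, boxPotential_eq_zero hr h (hb.2 h) ha.1] at hθab
    linarith
  have hsub : boxPotential r a b ≤ pairAvg (wedge α) (boxPotential r) a b := by
    have := sub_le_pairAvg_of_lap (A := fun _ => True) (c := 2) (by norm_num) (boxPotential_comm r)
      (fun z w => by simpa using lap_boxPotential r z w) hab
    simpa [hne] using this
  have h1 : θ a b + ε * driftFunction a <
      pairAvg (wedge α) (fun z w => θ z w + ε * driftFunction z) a b := by
    have e1 : pairAvg (wedge α) (fun z _ => ε * driftFunction z) a b =
        ε * avg (wedge α) driftFunction a := by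
      simp only [pairAvg, avg_const degree_pos, avg_const_mul]
    have e2 : pairAvg (wedge α) θ a b =
        1 / (3 * r) * pairAvg (wedge α) (boxPotential r) a b +
          pairAvg (wedge α) (avoidProb (wedge α)) a b - 1 := by
      rw [hθ, pairAvg_sub, pairAvg_add, pairAvg_const_mul, pairAvg_const degree_pos]
    rw [pairAvg_add θ, e1, e2]
    have h3 := avoidProb_le_pairAvg degree_pos hne
    have h4 := mul_lt_mul_of_pos_left (driftFunction_lt_avg a) hε0
    have h5 := mul_le_mul_of_nonneg_left hsub (one_div_pos.2 hr').le
    simp only [hθ]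
    linarith
  refine absurd h1 (not_lt.2 ?_)
  rw [← pairAvg_const (G := wedge α) degree_pos (θ a b + ε * driftFunction a) a b]
  refine pairAvg_mono_of_adj fun a' b' ha' hb' => hmax (a', b') ⟨inBox_of_adj hza ha',
    inBox_of_adj hzb hb', ?_⟩
  rw [parity_of_adj ha', parity_of_adj hb', hab]

theorem avoidProb_le_five_sixths (hα : α ≤ 1) {z w : Wedge α} (hzw : parity z = parity w) :
    avoidProb (wedge α) z w ≤ 5 / 6 := by
  obtain ⟨r, hr⟩ := exists_nat_gt (2 * (|(z.1.1 : ℝ) - w.1.1| + |(z.1.1 : ℝ) * w.1.1|) +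
    |(z.1.1 : ℝ)| + |(w.1.1 : ℝ)| + 1)
  have hn1 := abs_nonneg ((z.1.1 : ℝ) - w.1.1)
  have hn2 := abs_nonneg ((z.1.1 : ℝ) * w.1.1)
  have hn3 := abs_nonneg (z.1.1 : ℝ)
  have hn4 := abs_nonneg (w.1.1 : ℝ)
  have hr1 : (1 : ℝ) < r := by linarith
  have hr0 : 0 < r := by exact_mod_cast zero_lt_one.trans hr1
  have hz : |z.1.1| < r := by
    have : |(z.1.1 : ℝ)| < r := by linarith
    exact_mod_cast this
  have hw : |w.1.1| < r := by
    have : |(w.1.1 : ℝ)| < r := by linarith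
    exact_mod_cast this
  refine (avoidProb_le_of_inBox hα hr0 ⟨hz.le, fun h => absurd h hz.ne⟩
    ⟨hw.le, fun h => absurd h hw.ne⟩ hzw).trans ?_
  have h1 : -|(z.1.1 : ℝ) - w.1.1| ≤ treePotential z w := by
    have : -|z.1.1 - w.1.1| ≤ treePotential z w := by
      rw [treePotential]
      have hz2 : 0 ≤ z.1.2 := z.2.1
      have hw2 : 0 ≤ w.1.2 := w.2.1
      split_ifs <;> omega
    exact_mod_cast this
  have h2 : (z.1.1 : ℝ) * w.1.1 / r ≤ |(z.1.1 : ℝ) * w.1.1| :=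
    (div_le_div_of_nonneg_right (le_abs_self _) (Nat.cast_nonneg r)).trans
      (div_le_self hn2 hr1.le)
  have h3 : (r : ℝ) / 2 ≤ boxPotential r z w := by
    rw [boxPotential]; linarith
  have h4 : 1 / 6 ≤ boxPotential r z w / (3 * r) := by
    rw [le_div_iff₀ (by positivity)]; linarith
  linarith

/-- A collision occurs almost surely: the chance of avoiding it is at most `5 / 6` from the present
positions whatever has happened before, hence is multiplied by `5 / 6` by conditioning. -/
theorem avoidProb_eq_zero (hα : α ≤ 1) {z w : Wedge α} (hzw : parity z = parity w) :
    avoidProb (wedge α) z w = 0 := by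
  have key : ∀ N : ℕ, ∀ z w : Wedge α, parity z = parity w →
      avoidProb (wedge α) z w ≤ 5 / 6 * stayProb (wedge α) N (fun _ x y => x ≠ y) z w := by
    intro N
    induction N with
    | zero => intro z w h; simpa [stayProb] using avoidProb_le_five_sixths hα h
    | succ N ih =>
      intro z w h
      by_cases hne : z = w
      · subst hne
        rw [stayProb_succ_of_not (by simp), mul_zero]
        exact avoidProb_self z
      · rw [stayProb_succ_of hne, ← pairAvg_const_mul]
        refine (avoidProb_le_pairAvg degree_pos hne).trans (pairAvg_mono_of_adj fun z' w' hz hw => ?_)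
        exact ih z' w' (by rw [parity_of_adj hz, parity_of_adj hw, h])
  have h1 := ge_of_tendsto' ((tendsto_avoidProb (G := wedge α) degree_pos z w).const_mul (5 / 6))
    fun N => key N z w hzw
  linarith [avoidProb_nonneg (G := wedge α) z w]

theorem tendsto_stayProb_of_le (hα : α ≤ 1) (n : ℕ) {z w : Wedge α} (hzw : parity z = parity w) :
    Filter.Tendsto (fun N => stayProb (wedge α) (N + n) (fun t x y => n ≤ t → x ≠ y) z w)
      Filter.atTop (nhds 0) := by
  induction n generalizing z w with
  | zero =>
    simpa [avoidProb_eq_zero hα hzw] using tendsto_avoidProb degree_pos z w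
  | succ n ih =>
    have h1 (N : ℕ) : stayProb (wedge α) (N + (n + 1)) (fun t x y => n + 1 ≤ t → x ≠ y) z w =
        pairAvg (wedge α) (fun x y => if parity x = parity y then
          stayProb (wedge α) (N + n) (fun t x y => n ≤ t → x ≠ y) x y else 0) z w := by
      rw [← add_assoc, stayProb_succ_of (by simp)]
      simp only [add_le_add_iff_right]
      have hpar {x y : Wedge α} (hx : (wedge α).Adj z x) (hy : (wedge α).Adj w y) :
          parity x = parity y := by rw [parity_of_adj hx, parity_of_adj hy, hzw]
      exact le_antisymm
        (pairAvg_mono_of_adj fun x y hx hy => by rw [if_pos (hpar hx hy)])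
        (pairAvg_mono_of_adj fun x y hx hy => by rw [if_pos (hpar hx hy)])
    simp only [h1]
    refine (tendsto_pairAvg (h := fun _ _ => (0 : ℝ)) (fun x y => ?_) z w).trans_eq ?_
    · split_ifs with h
      · exact ih h
      · exact tendsto_const_nhds
    · rw [pairAvg_const degree_pos]

theorem infiniteCollisionProperty_of_le_one (hα : α ≤ 1) : InfiniteCollisionProperty (wedge α) := by
  intro a
  have h : ∀ n : ℕ, ∀ᵐ ω ∂(pairLaw (wedge α) a a), ∃ t, n ≤ t ∧ ω.1 t = ω.2 t := by
    intro n
    rw [ae_iff]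
    have hlim := ENNReal.tendsto_ofReal (tendsto_stayProb_of_le hα n (rfl : parity a = parity a))
    rw [ENNReal.ofReal_zero] at hlim
    refine le_antisymm (ge_of_tendsto' hlim fun N => ?_) zero_le
    rw [← pairLaw_forall_lt degree_pos]
    refine measure_mono fun ω hω t _ hn he => hω ⟨t, hn, he⟩
  filter_upwards [ae_all_iff.2 h] with ω hω
  rw [collisions, Set.encard_eq_top_iff]
  exact Set.infinite_of_forall_exists_gt fun n => by
    obtain ⟨t, ht, he⟩ := hω (n + 1)
    exact ⟨t, he, by omega⟩

end Recurrence

/-! ### Reversibility, heat kernel and energy -/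

section Reversible

variable {V : Type*} (G : SimpleGraph V) [G.LocallyFinite]

/-- The inner product of the reversible measure of simple random walk, which gives each vertex its
degree as mass. It is used when one of the functions has finite support. -/
noncomputable def degInner (f g : V → ℝ) : ℝ := ∑' x, G.degree x * (f x * g x)

/-- The function `x ↦ P_x(X_n = o)`. -/
noncomputable def heat (o : V) (n : ℕ) : V → ℝ := (avg G)^[n] (Set.indicator {o} 1)

variable {G}

theorem summable_degInner {f : V → ℝ} (hf : f.support.Finite) (g : V → ℝ) :
    Summable fun x => (G.degree x : ℝ) * (f x * g x) :=
  summable_of_hasFiniteSupport (hf.subset fun x hx hf0 => hx (by simp [hf0]))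

theorem degInner_comm (f g : V → ℝ) : degInner G f g = degInner G g f := by
  simp only [degInner, mul_comm (f _)]

theorem degInner_add_left {f f' : V → ℝ} (hf : f.support.Finite) (hf' : f'.support.Finite)
    (g : V → ℝ) : degInner G (fun x => f x + f' x) g = degInner G f g + degInner G f' g := by
  rw [degInner, degInner, degInner,
    ← (summable_degInner hf g).tsum_add (summable_degInner hf' g)]
  exact tsum_congr fun x => by ring

theorem degInner_sub_left {f f' : V → ℝ} (hf : f.support.Finite) (hf' : f'.support.Finite)
    (g : V → ℝ) : degInner G (fun x => f x - f' x) g = degInner G f g - degInner G f' g := by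
  rw [degInner, degInner, degInner,
    ← (summable_degInner hf g).tsum_sub (summable_degInner hf' g)]
  exact tsum_congr fun x => by ring

theorem degInner_add_right {f : V → ℝ} (hf : f.support.Finite) (g g' : V → ℝ) :
    degInner G f (fun x => g x + g' x) = degInner G f g + degInner G f g' := by
  rw [degInner, degInner, degInner,
    ← (summable_degInner hf g).tsum_add (summable_degInner hf g')]
  exact tsum_congr fun x => by ring

theorem degInner_sub_right {f : V → ℝ} (hf : f.support.Finite) (g g' : V → ℝ) :
    degInner G f (fun x => g x - g' x) = degInner G f g - degInner G f g' := by
  rw [degInner, degInner, degInner,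
    ← (summable_degInner hf g).tsum_sub (summable_degInner hf g')]
  exact tsum_congr fun x => by ring

theorem degInner_self_nonneg (f : V → ℝ) : 0 ≤ degInner G f f :=
  tsum_nonneg fun _ => mul_nonneg (Nat.cast_nonneg _) (mul_self_nonneg _)

theorem degInner_indicator_left (o : V) (g : V → ℝ) :
    degInner G (Set.indicator {o} 1) g = G.degree o * g o := by
  rw [degInner, tsum_eq_single o]
  · simp
  · intro x hx; simp [hx]

/-- The degree cancels the normalisation of `avg`, so sums with the degree as weight extend over
the edges. -/
theorem degree_mul_avg (hG : ∀ x, 0 < G.degree x) (g : V → ℝ) (x : V) :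
    (G.degree x : ℝ) * avg G g x = ∑ y ∈ G.neighborFinset x, g y := by
  have : (G.degree x : ℝ) ≠ 0 := by exact_mod_cast (hG x).ne'
  rw [avg]; field_simp

theorem support_avg_subset [DecidableEq V] {f : V → ℝ} {s : Finset V} (hf : f.support ⊆ s) :
    (avg G f).support ⊆ (s.biUnion fun x => G.neighborFinset x : Finset V) := by
  intro y hy
  by_contra hy'
  refine hy ?_
  rw [avg, Finset.sum_eq_zero, zero_div]
  intro x hx
  by_contra hfx
  refine hy' (Finset.mem_coe.2 (Finset.mem_biUnion.2 ⟨x, hf hfx, ?_⟩))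
  rw [SimpleGraph.mem_neighborFinset] at hx ⊢
  exact hx.symm

theorem finite_support_avg {f : V → ℝ} (hf : f.support.Finite) : (avg G f).support.Finite := by
  classical
  exact (Finset.finite_toSet _).subset
    (support_avg_subset (s := hf.toFinset) (by rw [Set.Finite.coe_toFinset]))

/-- The transition operator is self-adjoint for the reversible measure. -/
theorem degInner_avg (hG : ∀ x, 0 < G.degree x) {f : V → ℝ} (hf : f.support.Finite) (g : V → ℝ) :
    degInner G (avg G f) g = degInner G f (avg G g) := by
  classical
  set s := hf.toFinset with hs
  have hfs : f.support ⊆ s := by rw [hs, Set.Finite.coe_toFinset]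
  set t : Finset V := s.biUnion fun x => G.neighborFinset x with ht
  have hft : (avg G f).support ⊆ t := support_avg_subset hfs
  have hf0 {x : V} (hx : x ∉ s) : f x = 0 := by
    by_contra h; exact hx (hfs h)
  have ht0 {x : V} (hx : x ∉ t) : avg G f x = 0 := by
    by_contra h; exact hx (hft h)
  rw [degInner, degInner, tsum_eq_sum (s := t) fun x hx => by rw [ht0 hx]; ring,
    tsum_eq_sum (s := s) fun x hx => by rw [hf0 hx]; ring]
  have e1 (y : V) : (G.degree y : ℝ) * (avg G f y * g y) =
      ∑ x ∈ s, if G.Adj x y then f x * g y else 0 := by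
    rw [← mul_assoc, degree_mul_avg hG, Finset.sum_mul, ← Finset.sum_filter]
    refine (Finset.sum_subset (fun x hx => ?_) fun x hx hx' => ?_).symm
    · rw [SimpleGraph.mem_neighborFinset]; exact (Finset.mem_filter.1 hx).2.symm
    · have : x ∉ s := fun h => hx' (Finset.mem_filter.2 ⟨h, by
        rw [SimpleGraph.mem_neighborFinset] at hx; exact hx.symm⟩)
      rw [hf0 this, zero_mul]
  have e2 (x : V) (hx : x ∈ s) : (G.degree x : ℝ) * (f x * avg G g x) =
      ∑ y ∈ t, if G.Adj x y then f x * g y else 0 := by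
    rw [mul_left_comm, degree_mul_avg hG, Finset.mul_sum, ← Finset.sum_filter]
    refine Finset.sum_congr ?_ fun _ _ => rfl
    ext y
    rw [SimpleGraph.mem_neighborFinset, Finset.mem_filter]
    refine ⟨fun h => ⟨Finset.mem_biUnion.2 ⟨x, hx, ?_⟩, h⟩, fun h => h.2⟩
    rwa [SimpleGraph.mem_neighborFinset]
  rw [Finset.sum_congr rfl fun y _ => e1 y, Finset.sum_congr rfl e2, Finset.sum_comm]

theorem finite_support_iterate_avg {f : V → ℝ} (hf : f.support.Finite) (n : ℕ) :
    ((avg G)^[n] f).support.Finite := by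
  induction n with
  | zero => exact hf
  | succ n ih => rw [Function.iterate_succ_apply']; exact finite_support_avg ih

theorem degInner_iterate_avg (hG : ∀ x, 0 < G.degree x) {f : V → ℝ} (hf : f.support.Finite)
    (g : V → ℝ) (n : ℕ) :
    degInner G ((avg G)^[n] f) g = degInner G f ((avg G)^[n] g) := by
  induction n generalizing g with
  | zero => rfl
  | succ n ih =>
    rw [Function.iterate_succ_apply', degInner_avg hG (finite_support_iterate_avg hf n), ih,
      Function.iterate_succ_apply]

theorem finite_support_indicator (o : V) :
    (Set.indicator {o} (1 : V → ℝ)).support.Finite :=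
  (Set.finite_singleton o).subset Set.support_indicator_subset

theorem finite_support_heat (o : V) (n : ℕ) : (heat G o n).support.Finite :=
  finite_support_iterate_avg (finite_support_indicator o) n

theorem heat_zero (o : V) : heat G o 0 = Set.indicator {o} 1 := rfl

theorem heat_succ (o : V) (n : ℕ) : heat G o (n + 1) = avg G (heat G o n) :=
  Function.iterate_succ_apply' _ _ _

theorem heat_nonneg (o : V) (n : ℕ) (x : V) : 0 ≤ heat G o n x := by
  induction n generalizing x with
  | zero => exact Set.indicator_nonneg (fun _ _ => zero_le_one) x
  | succ n ih => rw [heat_succ]; exact avg_nonneg ih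

theorem heat_le_one (hG : ∀ x, 0 < G.degree x) (o : V) (n : ℕ) (x : V) : heat G o n x ≤ 1 := by
  induction n generalizing x with
  | zero => exact Set.indicator_le_self' (fun _ _ => zero_le_one) x
  | succ n ih => rw [heat_succ]; exact (avg_mono ih).trans_eq (avg_const hG 1 x)

theorem iterate_avg_heat (o : V) (m n : ℕ) : (avg G)^[m] (heat G o n) = heat G o (n + m) := by
  rw [heat, heat, ← Function.iterate_add_apply, add_comm]

theorem degInner_heat_heat (hG : ∀ x, 0 < G.degree x) (o : V) (m n : ℕ) :
    degInner G (heat G o m) (heat G o n) = G.degree o * heat G o (n + m) o := by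
  rw [heat, degInner_iterate_avg hG (finite_support_indicator o), iterate_avg_heat,
    degInner_indicator_left]

theorem degInner_heat_one (hG : ∀ x, 0 < G.degree x) (o : V) (n : ℕ) :
    degInner G (heat G o n) (fun _ => 1) = G.degree o := by
  induction n with
  | zero => rw [heat_zero, degInner_indicator_left, mul_one]
  | succ n ih =>
    rw [heat_succ, degInner_avg hG (finite_support_heat o n),
      show avg G (fun _ => (1 : ℝ)) = fun _ => 1 from funext fun x => avg_const hG 1 x, ih]

/-- Reversibility: `deg o * P_o(X_n = z) = deg z * P_z(X_n = o)`. -/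
theorem degree_mul_heat (hG : ∀ x, 0 < G.degree x) (o z : V) (n : ℕ) :
    (G.degree o : ℝ) * heat G z n o = G.degree z * heat G o n z := by
  rw [← degInner_indicator_left, ← degInner_indicator_left, heat, heat,
    ← degInner_iterate_avg hG (finite_support_indicator o), degInner_comm]

/-- Any part of the edge sum of the Dirichlet form, in which each edge is counted twice, is bounded
by its operator expression. -/
theorem sum_edges_le (hG : ∀ x, 0 < G.degree x) {F : V → ℝ} (hF : F.support.Finite)
    (s : Finset V) :
    ∑ x ∈ s, ∑ y ∈ G.neighborFinset x, (F x - F y) ^ 2 ≤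
      2 * degInner G F (fun x => F x - avg G F x) := by
  have hF2 : (fun x => F x ^ 2).support.Finite := hF.subset fun x hx h0 => hx (by simp [h0])
  have hΓ (x : V) : ∑ y ∈ G.neighborFinset x, (F x - F y) ^ 2 =
      2 * (G.degree x * (F x * (F x - avg G F x))) +
        (G.degree x * (avg G (fun x => F x ^ 2) x * 1) - G.degree x * (F x ^ 2 * 1)) := by
    have e : ∑ y ∈ G.neighborFinset x, (F x - F y) ^ 2 =
        G.degree x * F x ^ 2 + (∑ y ∈ G.neighborFinset x, F y ^ 2) -
          2 * F x * ∑ y ∈ G.neighborFinset x, F y := by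
      rw [Finset.mul_sum, ← SimpleGraph.card_neighborFinset_eq_degree, ← nsmul_eq_mul,
        ← Finset.sum_const, ← Finset.sum_add_distrib, ← Finset.sum_sub_distrib]
      exact Finset.sum_congr rfl fun y _ => by ring
    rw [e, ← degree_mul_avg hG, ← degree_mul_avg hG]
    ring
  have h1 := (summable_degInner (G := G) hF fun x => F x - avg G F x).mul_left 2
  have h2 := summable_degInner (G := G) (finite_support_avg (G := G) hF2) fun _ => 1
  have h3 := summable_degInner (G := G) hF2 fun _ => 1
  have hsum := h1.add (h2.sub h3)
  have htot : ∑' x, (2 * (G.degree x * (F x * (F x - avg G F x))) +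
      (G.degree x * (avg G (fun x => F x ^ 2) x * 1) - G.degree x * (F x ^ 2 * 1))) =
        2 * degInner G F (fun x => F x - avg G F x) := by
    rw [h1.tsum_add (h2.sub h3), h2.tsum_sub h3, tsum_mul_left]
    have : degInner G (avg G fun x => F x ^ 2) (fun _ => 1) =
        degInner G (fun x => F x ^ 2) (fun _ => 1) := by
      rw [degInner_avg hG hF2,
        show avg G (fun _ => (1 : ℝ)) = fun _ => 1 from funext fun x => avg_const hG 1 x]
    simp only [degInner] at this ⊢
    rw [this]; ring
  rw [← htot, Finset.sum_congr rfl fun x _ => hΓ x]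
  refine hsum.sum_le_tsum s fun x _ => ?_
  rw [← hΓ]
  exact Finset.sum_nonneg fun y _ => sq_nonneg _

/-- The gradient of `F` along edges `x, σ x` that have distinct starting points. -/
theorem sum_sq_sub_le (hG : ∀ x, 0 < G.degree x) {F : V → ℝ} (hF : F.support.Finite)
    {ι : Type*} (s : Finset ι) (v w : ι → V) (hv : Set.InjOn v s)
    (hadj : ∀ i ∈ s, G.Adj (v i) (w i)) :
    ∑ i ∈ s, (F (v i) - F (w i)) ^ 2 ≤ 2 * degInner G F (fun x => F x - avg G F x) := by
  classical
  refine le_trans ?_ (sum_edges_le hG hF (s.image v))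
  rw [Finset.sum_image hv]
  refine Finset.sum_le_sum fun i hi => ?_
  exact Finset.single_le_sum (f := fun y => (F (v i) - F y) ^ 2) (fun y _ => sq_nonneg _)
    ((G.mem_neighborFinset _ _).2 (hadj i hi))

variable (G) in
/-- `deg o * P_o(X_n = o)`. -/
noncomputable def returnMass (o : V) (n : ℕ) : ℝ := G.degree o * heat G o n o

theorem returnMass_nonneg (o : V) (n : ℕ) : 0 ≤ returnMass G o n :=
  mul_nonneg (Nat.cast_nonneg _) (heat_nonneg _ _ _)

/-- The decrements of the even return probabilities decrease, since the second difference is the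
square of a norm. -/
theorem returnMass_convex (hG : ∀ x, 0 < G.degree x) (o : V) (n : ℕ) :
    returnMass G o (2 * (n + 1)) - returnMass G o (2 * (n + 1) + 2) ≤
      returnMass G o (2 * n) - returnMass G o (2 * n + 2) := by
  have h := degInner_self_nonneg (G := G) fun x => heat G o n x - heat G o (n + 2) x
  rw [degInner_sub_left (finite_support_heat o n) (finite_support_heat o _),
    degInner_sub_right (finite_support_heat o n), degInner_sub_right (finite_support_heat o _),
    degInner_heat_heat hG, degInner_heat_heat hG, degInner_heat_heat hG,
    degInner_heat_heat hG, show n + 2 + (n + 2) = 2 * (n + 1) + 2 by ring,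
    show n + (n + 2) = 2 * n + 2 by ring, show n + 2 + n = 2 * n + 2 by ring,
    ← two_mul] at h
  simp only [returnMass, show 2 * (n + 1) = 2 * n + 2 by ring] at h ⊢
  linarith

theorem returnMass_antitone (hG : ∀ x, 0 < G.degree x) (o : V) :
    Antitone fun n => returnMass G o (2 * n) := by
  refine antitone_nat_of_succ_le fun n => ?_
  by_contra! hlt
  -- a first increase would persist by convexity and make the bounded sequence linear
  set δ := returnMass G o (2 * (n + 1)) - returnMass G o (2 * n) with hδ
  have hδ0 : 0 < δ := sub_pos.2 hlt
  have h1 : ∀ k, δ ≤ returnMass G o (2 * (n + k + 1)) - returnMass G o (2 * (n + k)) := by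
    intro k
    induction k with
    | zero => exact le_rfl
    | succ k ih =>
      have := returnMass_convex hG o (n + k)
      simp only [← add_assoc, mul_add, mul_one] at this ih ⊢
      linarith
  have h2 : ∀ k : ℕ, k * δ ≤ returnMass G o (2 * (n + k)) := by
    intro k
    induction k with
    | zero => simpa using returnMass_nonneg o _
    | succ k ih =>
      have := h1 k
      push_cast
      rw [← add_assoc]
      linarith
  have h3 : ∀ m, returnMass G o m ≤ G.degree o := fun m =>
    mul_le_of_le_one_right (Nat.cast_nonneg _) (heat_le_one hG o m o)
  obtain ⟨k, hk⟩ := exists_nat_gt (G.degree o / δ)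
  rw [div_lt_iff₀ hδ0] at hk
  linarith [h2 k, h3 (2 * (n + k))]

theorem mul_returnMass_sub_le (hG : ∀ x, 0 < G.degree x) (o : V) (m : ℕ) :
    m * (returnMass G o (4 * m) - returnMass G o (4 * m + 2)) ≤ returnMass G o (2 * m) := by
  have hanti : Antitone fun n => returnMass G o (2 * n) - returnMass G o (2 * n + 2) :=
    antitone_nat_of_succ_le fun n => returnMass_convex hG o n
  have h : ∀ k ≤ m, k * (returnMass G o (4 * m) - returnMass G o (4 * m + 2)) ≤
      returnMass G o (2 * m) - returnMass G o (2 * (m + k)) := by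
    intro k
    induction k with
    | zero => simp
    | succ k ih =>
      intro hk
      have h1 := hanti (show m + k ≤ 2 * m by omega)
      have h2 := ih (by omega)
      simp only [← mul_assoc] at h1
      norm_num only at h1
      push_cast
      rw [show 2 * (m + (k + 1)) = 2 * (m + k) + 2 by ring]
      linarith
  linarith [h m le_rfl, returnMass_nonneg (G := G) o (2 * (m + m))]

variable (G) in
/-- The sum of the heat kernels at two consecutive times. On a bipartite graph a single heat kernel
lives on one parity class; the sum is smooth along edges. -/
noncomputable def heatPair (o : V) (n : ℕ) (x : V) : ℝ := heat G o n x + heat G o (n + 1) x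

theorem finite_support_heatPair (o : V) (n : ℕ) : (heatPair G o n).support.Finite :=
  ((finite_support_heat o n).union (finite_support_heat o (n + 1))).subset
    (Function.support_add _ _)

theorem heatPair_nonneg (o : V) (n : ℕ) (x : V) : 0 ≤ heatPair G o n x :=
  add_nonneg (heat_nonneg _ _ _) (heat_nonneg _ _ _)

theorem degInner_heatPair_one (hG : ∀ x, 0 < G.degree x) (o : V) (n : ℕ) :
    degInner G (heatPair G o n) (fun _ => 1) = 2 * G.degree o := by
  have h : degInner G (heatPair G o n) (fun _ => 1) = _ :=
    degInner_add_left (finite_support_heat o n) (finite_support_heat o (n + 1)) _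
  rw [h, degInner_heat_one hG, degInner_heat_one hG, two_mul]

theorem degInner_heatPair_self (hG : ∀ x, 0 < G.degree x) (o : V) (n : ℕ)
    (hodd : ∀ n, heat G o (2 * n + 1) o = 0) :
    degInner G (heatPair G o n) (heatPair G o n) =
      returnMass G o (2 * n) + returnMass G o (2 * n + 2) := by
  have h1 := finite_support_heat (G := G) o n
  have h2 := finite_support_heat (G := G) o (n + 1)
  have h : degInner G (heatPair G o n) (heatPair G o n) = _ :=
    degInner_add_left h1 h2 (heatPair G o n)
  have h3 : degInner G (heat G o n) (heatPair G o n) = _ := degInner_add_right h1 _ _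
  have h4 : degInner G (heat G o (n + 1)) (heatPair G o n) = _ := degInner_add_right h2 _ _
  rw [h, h3, h4, degInner_heat_heat hG, degInner_heat_heat hG, degInner_heat_heat hG,
    degInner_heat_heat hG, show n + n = 2 * n by ring, show n + 1 + n = 2 * n + 1 by ring,
    show n + (n + 1) = 2 * n + 1 by ring, show n + 1 + (n + 1) = 2 * n + 2 by ring, hodd]
  simp [returnMass]

/-- The energy of the two-step heat kernel is a decrement of the even return probabilities. -/
theorem degInner_heatPair_sub_avg (hG : ∀ x, 0 < G.degree x) (o : V) (n : ℕ)
    (hodd : ∀ n, heat G o (2 * n + 1) o = 0) :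
    degInner G (heatPair G o n) (fun x => heatPair G o n x - avg G (heatPair G o n) x) =
      returnMass G o (2 * n) - returnMass G o (2 * n + 2) := by
  have h1 := finite_support_heat (G := G) o n
  have h2 := finite_support_heat (G := G) o (n + 1)
  have e : (fun x => heatPair G o n x - avg G (heatPair G o n) x) =
      fun x => heat G o n x - heat G o (n + 2) x := by
    funext x
    have : avg G (heatPair G o n) x = heat G o (n + 1) x + heat G o (n + 2) x := by
      rw [heat_succ o (n + 1), heat_succ o n]
      exact (avg_add _ _ x).trans (by rw [← heat_succ o n])
    rw [this, heatPair]; ring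
  have h : degInner G (heatPair G o n) (fun x => heat G o n x - heat G o (n + 2) x) = _ :=
    degInner_add_left h1 h2 _
  rw [e, h, degInner_sub_right h1, degInner_sub_right h2, degInner_heat_heat hG,
    degInner_heat_heat hG, degInner_heat_heat hG, degInner_heat_heat hG,
    show n + n = 2 * n by ring, show n + 2 + n = 2 * n + 2 by ring,
    show n + (n + 1) = 2 * n + 1 by ring, show n + 2 + (n + 1) = 2 * (n + 1) + 1 by ring,
    hodd, hodd]
  simp [returnMass]

end Reversible

/-! ### Heat kernel bounds on the wedge comb -/

section HeatKernel

variable {α : ℝ}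

theorem sum_abs_le_sqrt {ι : Type*} (s : Finset ι) (a : ι → ℝ) {n : ℕ} (hn : s.card = n) {D : ℝ}
    (hD : ∑ i ∈ s, a i ^ 2 ≤ D) : ∑ i ∈ s, |a i| ≤ √(n * D) := by
  refine Real.le_sqrt_of_sq_le ?_
  refine (sq_sum_le_card_mul_sum_sq (s := s) (f := fun i => |a i|)).trans ?_
  simp only [sq_abs, hn]
  exact mul_le_mul_of_nonneg_left hD (Nat.cast_nonneg _)

theorem abs_sub_le_sum_abs (b : ℕ → ℝ) {m n : ℕ} (hmn : m ≤ n) :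
    |b 0 - b m| ≤ ∑ j ∈ Finset.range n, |b j - b (j + 1)| := by
  rw [← Finset.sum_range_sub' b m]
  exact (Finset.abs_sum_le_sum_abs _ _).trans (Finset.sum_le_sum_of_subset_of_nonneg
    (Finset.range_mono hmn) fun _ _ _ => abs_nonneg _)

theorem adj_vtx_step {σ : ℤ} (hσ : σ = 1 ∨ σ = -1) (l : ℤ) (j : ℕ) :
    (wedge α).Adj (vtx α (l + σ * j) 0) (vtx α (l + σ * (j + 1 : ℕ)) 0) := by
  rcases hσ with rfl | rfl
  · have := adj_vtx_right (α := α) (l + j)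
    rw [show l + 1 * (j : ℤ) = l + j by ring,
      show l + 1 * ((j + 1 : ℕ) : ℤ) = l + j + 1 by push_cast; ring]
    exact this
  · have := (adj_vtx_right (α := α) (l - j - 1)).symm
    rw [show l + -1 * (j : ℤ) = l - j - 1 + 1 by ring,
      show l + -1 * ((j + 1 : ℕ) : ℤ) = l - j - 1 by push_cast; ring]
    exact this

theorem sum_le_degInner {ι : Type*} {f g : Wedge α → ℝ} (hf : f.support.Finite)
    (hfg : ∀ x, 0 ≤ f x * g x) (s : Finset ι) (v : ι → Wedge α) (hv : Set.InjOn v s) :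
    ∑ i ∈ s, f (v i) * g (v i) ≤ degInner (wedge α) f g := by
  classical
  have h := (summable_degInner (G := wedge α) hf g).sum_le_tsum (s.image v)
    fun x _ => mul_nonneg (Nat.cast_nonneg _) (hfg x)
  rw [Finset.sum_image hv] at h
  refine le_trans (Finset.sum_le_sum fun i _ => ?_) h
  exact le_mul_of_one_le_left (hfg _) (by exact_mod_cast degree_pos (v i))

/-- Pointwise bound on the backbone by mass and energy: the value at `(l, 0)` is compared with the
average over `r` teeth of height `h`, at distances between `r` and `2 r` from `l` and pointing
away from the origin. Averaging over the teeth shares the tooth energy among them. -/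
theorem mul_apply_backbone_le {F : Wedge α → ℝ} (hF : F.support.Finite) (hF0 : ∀ x, 0 ≤ F x)
    {r h : ℕ} (hh : ∀ x : ℤ, (r : ℤ) ≤ |x| → h ≤ height α x) (l : ℤ) :
    r * h * F (vtx α l 0) ≤ degInner (wedge α) F (fun _ => 1) +
      r * h * √((2 * r : ℕ) * (2 * degInner (wedge α) F fun x => F x - avg (wedge α) F x)) +
      h * √((r * h : ℕ) * (2 * degInner (wedge α) F fun x => F x - avg (wedge α) F x)) := by
  set D := 2 * degInner (wedge α) F fun x => F x - avg (wedge α) F x with hD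
  obtain ⟨σ, hσ, hσl⟩ : ∃ σ : ℤ, (σ = 1 ∨ σ = -1) ∧ ∀ j : ℕ, (j : ℤ) ≤ |l + σ * j| := by
    rcases le_total 0 l with h0 | h0
    · exact ⟨1, Or.inl rfl, fun j => by rw [abs_of_nonneg] <;> omega⟩
    · exact ⟨-1, Or.inr rfl, fun j => by rw [abs_of_nonpos] <;> omega⟩
  have hσ0 : σ ≠ 0 := by rcases hσ with rfl | rfl <;> norm_num
  have hinj {i i' : ℕ} (e : l + σ * i = l + σ * i') : i = i' := by
    have := mul_left_cancel₀ hσ0 (add_left_cancel e)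
    exact_mod_cast this
  set b : ℕ → ℝ := fun j => F (vtx α (l + σ * j) 0) with hb
  have hb0 : b 0 = F (vtx α l 0) := by simp [hb]
  have hpath : ∑ j ∈ Finset.range (2 * r), |b j - b (j + 1)| ≤ √((2 * r : ℕ) * D) := by
    refine sum_abs_le_sqrt _ _ (Finset.card_range _) ?_
    refine sum_sq_sub_le degree_pos hF (Finset.range (2 * r)) (fun j : ℕ => vtx α (l + σ * j) 0)
      (fun j : ℕ => vtx α (l + σ * (j + 1 : ℕ)) 0) ?_ fun j _ => adj_vtx_step hσ l j
    intro i _ j _ e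
    exact hinj ((vtx_inj (Nat.zero_le _) (Nat.zero_le _)).1 e).1
  set x : ℕ → ℤ := fun i => l + σ * (r + i : ℕ) with hx
  have hxh (i : ℕ) : h ≤ height α (x i) := hh _ (le_trans (by push_cast; omega) (hσl (r + i)))
  have hxinj {i i' : ℕ} (e : x i = x i') : i = i' := by have := hinj e; omega
  have hbox : Set.InjOn (fun p : ℕ × ℕ => vtx α (x p.1) p.2)
      (Finset.range r ×ˢ Finset.range h : Finset (ℕ × ℕ)) := by
    rintro ⟨i, j⟩ hp ⟨i', j'⟩ hp' e
    simp only [Finset.coe_product, Set.mem_prod, Finset.mem_coe, Finset.mem_range] at hp hp'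
    have h1 := hxh i
    have h2 := hxh i'
    dsimp only at e
    obtain ⟨e1, e2⟩ := (vtx_inj (by omega) (by omega)).1 e
    rw [hxinj e1, e2]
  have hmass : ∑ i ∈ Finset.range r, ∑ j ∈ Finset.range h, F (vtx α (x i) j) ≤
      degInner (wedge α) F fun _ => 1 := by
    rw [← Finset.sum_product']
    simpa using sum_le_degInner hF (g := fun _ => 1) (fun x => by simpa using hF0 x)
      (Finset.range r ×ˢ Finset.range h) (fun p : ℕ × ℕ => vtx α (x p.1) p.2) hbox
  have hteeth : ∑ i ∈ Finset.range r, ∑ j ∈ Finset.range h,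
      |F (vtx α (x i) j) - F (vtx α (x i) (j + 1))| ≤ √((r * h : ℕ) * D) := by
    rw [← Finset.sum_product']
    refine sum_abs_le_sqrt (Finset.range r ×ˢ Finset.range h)
      (fun p : ℕ × ℕ => F (vtx α (x p.1) p.2) - F (vtx α (x p.1) (p.2 + 1))) (by simp) ?_
    refine sum_sq_sub_le degree_pos hF _ (fun p : ℕ × ℕ => vtx α (x p.1) p.2)
      (fun p : ℕ × ℕ => vtx α (x p.1) (p.2 + 1)) hbox fun p hp => adj_vtx_up ?_
    have := hxh p.1
    have := Finset.mem_range.1 (Finset.mem_product.1 hp).2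
    omega
  have hpt : ∀ i ∈ Finset.range r, ∀ j ∈ Finset.range h, F (vtx α l 0) ≤
      F (vtx α (x i) j) + √((2 * r : ℕ) * D) +
        ∑ j ∈ Finset.range h, |F (vtx α (x i) j) - F (vtx α (x i) (j + 1))| := by
    intro i hi j hj
    have h1 := (abs_sub_le_sum_abs b (show r + i ≤ 2 * r by
      have := Finset.mem_range.1 hi; omega)).trans hpath
    have h2 := abs_sub_le_sum_abs (fun j => F (vtx α (x i) j)) (Finset.mem_range.1 hj).le
    have h3 := le_abs_self (b 0 - b (r + i))
    have h4 := le_abs_self (F (vtx α (x i) 0) - F (vtx α (x i) j))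
    have h5 : b (r + i) = F (vtx α (x i) 0) := rfl
    linarith
  have hsum := Finset.sum_le_sum fun i hi => Finset.sum_le_sum fun j hj => hpt i hi j hj
  simp only [Finset.sum_add_distrib, Finset.sum_const, Finset.card_range, nsmul_eq_mul,
    ← Finset.mul_sum] at hsum
  have h6 := mul_le_mul_of_nonneg_left hteeth (Nat.cast_nonneg (α := ℝ) h)
  simp only [← mul_assoc] at hsum h6 ⊢
  linarith

/-- On long teeth the values on the backbone are controlled by the mean square over the tooth and
the energy. -/
theorem mul_sum_sq_backbone_le {F : Wedge α → ℝ} (hF : F.support.Finite) {h : ℕ} (T : Finset ℤ)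
    (hT : ∀ x ∈ T, h ≤ height α x) :
    h * ∑ l ∈ T, F (vtx α l 0) ^ 2 ≤ 2 * degInner (wedge α) F F +
      2 * h ^ 2 * (2 * degInner (wedge α) F fun x => F x - avg (wedge α) F x) := by
  have hbox : Set.InjOn (fun p : ℤ × ℕ => vtx α p.1 p.2)
      (T ×ˢ Finset.range h : Finset (ℤ × ℕ)) := by
    rintro ⟨i, j⟩ hp ⟨i', j'⟩ hp' e
    simp only [Finset.coe_product, Set.mem_prod, Finset.mem_coe, Finset.mem_range] at hp hp'
    have h1 := hT i hp.1
    have h2 := hT i' hp'.1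
    dsimp only at e
    obtain ⟨e1, e2⟩ := (vtx_inj (by omega) (by omega)).1 e
    rw [e1, e2]
  have hmass : ∑ l ∈ T, ∑ j ∈ Finset.range h, F (vtx α l j) * F (vtx α l j) ≤
      degInner (wedge α) F F := by
    rw [← Finset.sum_product']
    exact sum_le_degInner hF (fun x => mul_self_nonneg _)
      (T ×ˢ Finset.range h) (fun p : ℤ × ℕ => vtx α p.1 p.2) hbox
  have hteeth : ∑ l ∈ T, ∑ j ∈ Finset.range h,
      (F (vtx α l j) - F (vtx α l (j + 1))) ^ 2 ≤
        2 * degInner (wedge α) F fun x => F x - avg (wedge α) F x := by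
    rw [← Finset.sum_product']
    refine sum_sq_sub_le degree_pos hF (T ×ˢ Finset.range h) (fun p : ℤ × ℕ => vtx α p.1 p.2)
      (fun p : ℤ × ℕ => vtx α p.1 (p.2 + 1)) hbox fun p hp => adj_vtx_up ?_
    have := hT _ (Finset.mem_product.1 hp).1
    have := Finset.mem_range.1 (Finset.mem_product.1 hp).2
    omega
  have hpt : ∀ l ∈ T, ∀ j ∈ Finset.range h, F (vtx α l 0) ^ 2 ≤
      2 * (F (vtx α l j) * F (vtx α l j)) + 2 * h * ∑ j ∈ Finset.range h,
        (F (vtx α l j) - F (vtx α l (j + 1))) ^ 2 := by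
    intro l hl j hj
    have h2 := abs_sub_le_sum_abs (fun j => F (vtx α l j)) (Finset.mem_range.1 hj).le
    have h3 := sq_sum_le_card_mul_sum_sq (s := Finset.range h)
      (f := fun j => |F (vtx α l j) - F (vtx α l (j + 1))|)
    simp only [sq_abs, Finset.card_range] at h3
    have h4 := pow_le_pow_left₀ (abs_nonneg _) h2 2
    simp only [sq_abs] at h4
    nlinarith [sq_nonneg (F (vtx α l 0) - 2 * F (vtx α l j))]
  have hsum := Finset.sum_le_sum fun i hi => Finset.sum_le_sum fun j hj => hpt i hi j hj
  simp only [Finset.sum_add_distrib, Finset.sum_const, Finset.card_range, nsmul_eq_mul,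
    ← Finset.mul_sum] at hsum
  have h6 := mul_le_mul_of_nonneg_left hteeth (sq_nonneg (h : ℝ))
  linarith

variable (α) in
/-- The vertex at the origin. -/
noncomputable def origin : Wedge α := vtx α 0 0

theorem heat_eq_zero_of_parity {o x : Wedge α} {n : ℕ} (h : parity x ≠ parity o + n) :
    heat (wedge α) o n x = 0 := by
  induction n generalizing x with
  | zero =>
    rw [heat_zero, Set.indicator_of_notMem]
    rintro rfl
    simp at h
  | succ n ih =>
    rw [heat_succ, ← avg_const (G := wedge α) degree_pos 0 x]
    refine avg_congr_of_adj fun y hy => ih fun e => h ?_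
    have := parity_of_adj hy.symm
    rw [this, e]; push_cast; ring

theorem heat_odd_self (o : Wedge α) (n : ℕ) : heat (wedge α) o (2 * n + 1) o = 0 := by
  refine heat_eq_zero_of_parity fun h => ?_
  have h2 : ((2 * n + 1 : ℕ) : ZMod 2) = 1 := by
    push_cast; rw [show (2 : ZMod 2) = 0 from rfl]; ring
  rw [h2] at h
  simp at h

/-- The numerical part of `sum_sq_heatPair_le` for the teeth of length at least `A`. -/
theorem far_sum_le {s A h D q X N : ℝ} (hs0 : 0 < s) (hA0 : 0 < A) (hAs : A ≤ s ^ 2) (hh0 : 0 < h)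
    (hh1 : h ≤ A) (hh2 : A ≤ 2 * h) (hD0 : 0 ≤ D) (hq0 : 0 < q) (hqA : q * (s * A) = 1)
    (hsD : s * D ≤ 468 * q ^ 2) (hN : N ≤ 468 * q) (hX : h * X ≤ 2 * N + 2 * h ^ 2 * D) :
    X ≤ 2808 / (s * A ^ 2) := by
  have hq : 2808 / (s * A ^ 2) = 2808 * q / A := by
    rw [div_eq_div_iff (by positivity) hA0.ne']
    calc 2808 * A = 2808 * A * (q * (s * A)) := by rw [hqA, mul_one]
      _ = _ := by ring
  have h1 : q ^ 2 * A ^ 3 ≤ 1 := by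
    calc q ^ 2 * A ^ 3 = (q * A) ^ 2 * A := by ring
      _ ≤ (q * A) ^ 2 * s ^ 2 := by gcongr
      _ = (q * (s * A)) ^ 2 := by ring
      _ = 1 := by rw [hqA, one_pow]
  have h2 : D * A ^ 2 ≤ 468 * q := by
    calc D * A ^ 2 = (q * (s * A)) * (D * A ^ 2) := by rw [hqA, one_mul]
      _ = (s * D) * (q * A ^ 3) := by ring
      _ ≤ (468 * q ^ 2) * (q * A ^ 3) := by gcongr
      _ = 468 * q * (q ^ 2 * A ^ 3) := by ring
      _ ≤ 468 * q * 1 := by gcongr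
      _ = 468 * q := mul_one _
  rw [hq, le_div_iff₀ hA0]
  refine le_of_mul_le_mul_left ?_ hh0
  have h3 : h * D * A ≤ 468 * q := by
    calc h * D * A ≤ A * D * A := by gcongr
      _ = D * A ^ 2 := by ring
      _ ≤ _ := h2
  calc h * (X * A) = A * (h * X) := by ring
    _ ≤ A * (2 * N + 2 * h ^ 2 * D) := by gcongr
    _ = 2 * (A * N) + 2 * h * (h * D * A) := by ring
    _ ≤ 2 * (2 * h * (468 * q)) + 2 * h * (468 * q) := by
        have : A * N ≤ 2 * h * (468 * q) := by
          calc A * N ≤ A * (468 * q) := by gcongr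
            _ ≤ 2 * h * (468 * q) := by gcongr
        gcongr
    _ = h * (2808 * q) := by ring

/-- The main heat kernel estimate: at time `s ^ 2 * A` the walk has spread over `s` teeth up to
height `A`, and its collision rate on the backbone is of order `1 / (s * A ^ 2)`. -/
theorem sum_sq_heatPair_le {m : ℕ} {s A : ℝ} (hs : 1 ≤ s) (hA : 1 ≤ A) (hAs : A ≤ s ^ 2)
    (hm : (m : ℝ) = s ^ 2 * A) (hh : ∀ x : ℤ, s ≤ |(x : ℝ)| → ⌊A⌋₊ ≤ height α x) (T : Finset ℤ) :
    ∑ l ∈ T, heatPair (wedge α) (origin α) (2 * m) (vtx α l 0) ^ 2 ≤ 30000 / (s * A ^ 2) := by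
  have hs0 : 0 < s := by linarith
  have hA0 : 0 < A := by linarith
  set F := heatPair (wedge α) (origin α) (2 * m) with hF
  have hFf : F.support.Finite := finite_support_heatPair _ _
  have hF0 : ∀ x, 0 ≤ F x := heatPair_nonneg _ _
  set r := ⌈s⌉₊ with hr
  set h := ⌊A⌋₊ with hhdef
  have hr1 : s ≤ r := Nat.le_ceil s
  have hr2 : (r : ℝ) ≤ 2 * s := by linarith [Nat.ceil_lt_add_one hs0.le]
  have hh1 : (h : ℝ) ≤ A := Nat.floor_le hA0.le
  have hh3 : (1 : ℝ) ≤ h := by exact_mod_cast Nat.one_le_floor_iff A |>.2 hA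
  have hh2 : A ≤ 2 * h := by linarith [Nat.lt_floor_add_one A]
  have hr0 : (0 : ℝ) < r := by linarith
  have hh0 : (0 : ℝ) < h := by linarith
  have hheight (x : ℤ) (hx : (r : ℤ) ≤ |x|) : h ≤ height α x := by
    refine hh x (hr1.trans ?_)
    exact_mod_cast hx
  set D := 2 * degInner (wedge α) F fun x => F x - avg (wedge α) F x with hD
  set u := returnMass (wedge α) (origin α) (2 * m) with hu
  have hu0 : 0 ≤ u := returnMass_nonneg _ _
  set q := 1 / (s * A) with hq
  have hq0 : 0 < q := by positivity
  have hqA : q * (s * A) = 1 := by rw [hq]; field_simp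
  have hD' : D = 2 * (returnMass (wedge α) (origin α) (4 * m) -
      returnMass (wedge α) (origin α) (4 * m + 2)) := by
    rw [hD, hF, degInner_heatPair_sub_avg degree_pos _ _ (heat_odd_self _)]
    rw [show 2 * (2 * m) = 4 * m by ring]
  have hanti := returnMass_antitone (G := wedge α) degree_pos (origin α)
  have hD0 : 0 ≤ D := by
    have := hanti (show 2 * m ≤ 2 * m + 1 by omega)
    simp only [show 2 * (2 * m) = 4 * m by ring, show 2 * (2 * m + 1) = 4 * m + 2 by ring] at this
    rw [hD']; linarith
  -- the energy bound, in the form in which it is used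
  have hsD : s * D ≤ 2 * u * q := by
    have h1 := mul_returnMass_sub_le (G := wedge α) degree_pos (origin α) m
    have h2 : (s ^ 2 * A) * D ≤ 2 * u := by rw [← hm, hD']; linarith
    have h3 : s * D = q * ((s ^ 2 * A) * D) := by
      calc s * D = (q * (s * A)) * (s * D) := by rw [hqA, one_mul]
        _ = _ := by ring
    rw [h3]
    nlinarith
  have hdeg : ((wedge α).degree (origin α) : ℝ) ≤ 3 := by exact_mod_cast degree_le_three _
  have hpoint (l : ℤ) : F (vtx α l 0) ≤ 12 * q + 3 * √(s * D) := by
    have h1 := mul_apply_backbone_le hFf hF0 hheight l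
    rw [← hD, hF, degInner_heatPair_one degree_pos, ← hF] at h1
    have h2 : √((2 * r : ℕ) * D) ≤ 2 * √(s * D) := by
      rw [show (2 : ℝ) = √4 by rw [show (4 : ℝ) = 2 ^ 2 by norm_num]; simp,
        ← Real.sqrt_mul (by norm_num)]
      refine Real.sqrt_le_sqrt ?_
      push_cast
      nlinarith
    have h3 : √((r * h : ℕ) * D) ≤ r * √(s * D) := by
      rw [show (r : ℝ) * √(s * D) = √(r ^ 2 * (s * D)) by
        rw [Real.sqrt_mul (sq_nonneg _), Real.sqrt_sq hr0.le]]
      refine Real.sqrt_le_sqrt ?_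
      push_cast
      have : (h : ℝ) ≤ r * s := by nlinarith
      calc (r : ℝ) * h * D ≤ r * (r * s) * D := by gcongr
        _ = r ^ 2 * (s * D) := by ring
    have hrh : (0 : ℝ) < r * h := by positivity
    have h4 : (r : ℝ) * h * F (vtx α l 0) ≤ r * h * (12 * q + 3 * √(s * D)) := by
      have h5 := mul_le_mul_of_nonneg_left h2 hrh.le
      have h6 := mul_le_mul_of_nonneg_left h3 hh0.le
      have h7 : 1 ≤ r * h * (2 * q) := by
        have : s * A ≤ r * (2 * h) := mul_le_mul hr1 hh2 hA0.le hr0.le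
        nlinarith
      linarith
    exact le_of_mul_le_mul_left h4 hrh
  have hub : u ≤ 234 * q := by
    have h1 : u ≤ 3 * F (origin α) := by
      have h2 : heat (wedge α) (origin α) (2 * m) (origin α) ≤ F (origin α) :=
        le_add_of_nonneg_right (heat_nonneg _ _ _)
      exact mul_le_mul hdeg h2 (heat_nonneg _ _ _) (by norm_num)
    have h2 := hpoint 0
    rw [← origin] at h2
    have h3 : √(s * D) ≤ √(2 * u * q) := Real.sqrt_le_sqrt hsD
    -- by the inequality of the means, the square root is absorbed into half of `u`
    have h4 : 9 * √(2 * u * q) ≤ (u + 162 * q) / 2 := by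
      have h5 : √(2 * u * q) ^ 2 = 2 * u * q := Real.sq_sqrt (by positivity)
      refine abs_le_of_sq_le_sq' ?_ (by positivity) |>.2
      nlinarith [sq_nonneg (u - 162 * q)]
    linarith
  have hsD2 : s * D ≤ 468 * q ^ 2 := by nlinarith
  have hpoint2 (l : ℤ) : F (vtx α l 0) ≤ 78 * q := by
    have h3 : √(s * D) ≤ 22 * q := Real.sqrt_le_iff.2 ⟨by positivity, by nlinarith⟩
    linarith [hpoint l]
  have hnorm : degInner (wedge α) F F ≤ 468 * q := by
    rw [hF, degInner_heatPair_self degree_pos _ _ (heat_odd_self _)]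
    have h1 := hanti (show m ≤ 2 * m by omega)
    have h2 := hanti (show m ≤ 2 * m + 1 by omega)
    simp only [show 2 * (2 * m + 1) = 2 * (2 * m) + 2 by ring] at h1 h2
    linarith
  rw [← Finset.sum_filter_add_sum_filter_not T fun l => (r : ℤ) ≤ |l|]
  have hfar : ∑ l ∈ T with (r : ℤ) ≤ |l|, F (vtx α l 0) ^ 2 ≤ 2808 / (s * A ^ 2) := by
    have h1 := mul_sum_sq_backbone_le hFf (h := h) (T.filter fun l => (r : ℤ) ≤ |l|)
      fun x hx => hheight x (Finset.mem_filter.1 hx).2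
    rw [← hD] at h1
    set X := ∑ l ∈ T with (r : ℤ) ≤ |l|, F (vtx α l 0) ^ 2
    exact far_sum_le hs0 hA0 hAs hh0 hh1 hh2 hD0 hq0 hqA hsD2 hnorm h1
  have hnear : ∑ l ∈ T with ¬ (r : ℤ) ≤ |l|, F (vtx α l 0) ^ 2 ≤ 24336 / (s * A ^ 2) := by
    have hcard : ((T.filter fun l => ¬ (r : ℤ) ≤ |l|).card : ℝ) ≤ 4 * s := by
      have h1 : (T.filter fun l => ¬ (r : ℤ) ≤ |l|) ⊆ Finset.Ico (-r : ℤ) r := by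
        intro l hl
        have := not_le.1 (Finset.mem_filter.1 hl).2
        rw [abs_lt] at this
        exact Finset.mem_Ico.2 ⟨this.1.le, this.2⟩
      have h2 := Finset.card_le_card h1
      rw [Int.card_Ico, show ((r : ℤ) - -r).toNat = 2 * r by omega] at h2
      have h3 : ((T.filter fun l => ¬ (r : ℤ) ≤ |l|).card : ℝ) ≤ 2 * r := by exact_mod_cast h2
      linarith
    have h1 : ∑ l ∈ T with ¬ (r : ℤ) ≤ |l|, F (vtx α l 0) ^ 2 ≤
        ∑ l ∈ T with ¬ (r : ℤ) ≤ |l|, (78 * q) ^ 2 :=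
      Finset.sum_le_sum fun l _ => pow_le_pow_left₀ (hF0 _) (hpoint2 l) 2
    rw [Finset.sum_const, nsmul_eq_mul] at h1
    refine h1.trans ((mul_le_mul_of_nonneg_right hcard (sq_nonneg _)).trans_eq ?_)
    rw [hq]; field_simp; norm_num
  have h5 : 30000 / (s * A ^ 2) =
      2808 / (s * A ^ 2) + 24336 / (s * A ^ 2) + 2856 / (s * A ^ 2) := by ring
  have h6 : 0 ≤ 2856 / (s * A ^ 2) := by positivity
  linarith

/-- Collision rate on the backbone, as a power of time; the exponent exceeds `1`
since `β > 1`. -/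
theorem sum_sq_heatPair_le_rpow {β : ℝ} (hβ : 1 < β) (hβα : β ≤ α) (hβ2 : β ≤ 2) {m : ℕ}
    (hm : 1 ≤ m) (T : Finset ℤ) :
    ∑ l ∈ T, heatPair (wedge α) (origin α) (2 * m) (vtx α l 0) ^ 2 ≤
      30000 * (m : ℝ) ^ (-((1 + 2 * β) / (2 + β))) := by
  have hm1 : (1 : ℝ) ≤ m := by exact_mod_cast hm
  have hm0 : (0 : ℝ) < m := by linarith
  set s : ℝ := (m : ℝ) ^ (1 / (2 + β)) with hs
  have hs1 : 1 ≤ s := Real.one_le_rpow hm1 (by positivity)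
  have hs0 : 0 < s := by linarith
  have hA1 : 1 ≤ s ^ β := Real.one_le_rpow hs1 (by linarith)
  have hAs : s ^ β ≤ s ^ 2 := by
    rw [← Real.rpow_two]; exact Real.rpow_le_rpow_of_exponent_le hs1 hβ2
  have hpow (c : ℝ) : s ^ c = (m : ℝ) ^ (c / (2 + β)) := by
    rw [hs, ← Real.rpow_mul hm0.le]; congr 1; ring
  have hsm : (m : ℝ) = s ^ 2 * s ^ β := by
    rw [← Real.rpow_two, ← Real.rpow_add hs0, hpow, div_self (by linarith), Real.rpow_one]
  refine (sum_sq_heatPair_le hs1 hA1 hAs hsm (fun x hx => ?_) T).trans_eq ?_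
  · refine Nat.floor_le_floor ?_
    rw [powerProfile]
    exact (Real.rpow_le_rpow hs0.le hx (by linarith)).trans
      (Real.rpow_le_rpow_of_exponent_le (hs1.trans hx) hβα)
  · rw [Real.rpow_neg hm0.le, ← hpow, ← div_eq_mul_inv]
    congr 1
    rw [← Real.rpow_natCast, ← Real.rpow_mul hs0.le]
    nth_rewrite 1 [← Real.rpow_one s]
    rw [← Real.rpow_add hs0]
    congr 1; push_cast; ring

end HeatKernel

/-! ### Occupation and collisions in the teeth -/

section Occupation

variable {V : Type*} {G : SimpleGraph V} [G.LocallyFinite]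

theorem sq_avg_le (g : V → ℝ) (x : V) : avg G g x ^ 2 ≤ avg G (fun y => g y ^ 2) x := by
  rw [avg, avg, div_pow]
  have h := sq_sum_le_card_mul_sum_sq (s := G.neighborFinset x) (f := g)
  rw [SimpleGraph.card_neighborFinset_eq_degree] at h
  rcases (Nat.cast_nonneg (α := ℝ) (G.degree x)).eq_or_lt with h0 | h0
  · simp [← h0]
  · rw [div_le_div_iff₀ (by positivity) h0]
    nlinarith

/-- Chapman–Kolmogorov, keeping only the trajectories that are at `a` at time `n`. -/
theorem heat_mul_heat_le (a z : V) (n t : ℕ) (x : V) :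
    heat G a n x * heat G z t a ≤ heat G z (t + n) x := by
  induction n generalizing x with
  | zero =>
    by_cases h : x = a
    · subst h; simp [heat_zero]
    · simpa [heat_zero, h] using heat_nonneg z t x
  | succ n ih =>
    rw [heat_succ, ← add_assoc, heat_succ, ← avg_mul_const]
    exact avg_mono ih

/-- Visiting `(a, a)` first gives a lower bound for the probability that a constraint is
violated. -/
theorem heat_mul_one_sub_stayProb_le (hG : ∀ x, 0 < G.degree x) (S : V → V → Prop) (a : V)
    (T n : ℕ) (x y : V) :
    heat G a n x * heat G a n y * (1 - stayProb G T (fun _ => S) a a) ≤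
      1 - stayProb G (T + n) (fun _ => S) x y := by
  induction n generalizing x y with
  | zero =>
    by_cases h : x = a ∧ y = a
    · obtain ⟨rfl, rfl⟩ := h
      simp [heat_zero]
    · have h0 : heat G a 0 x * heat G a 0 y = 0 := by
        rw [not_and_or] at h
        rcases h with h | h <;> simp [heat_zero, h]
      rw [h0, zero_mul]
      exact sub_nonneg.2 (stayProb_le_one hG _ _ _ _)
  | succ n ih =>
    by_cases h : S x y
    · rw [← add_assoc, stayProb_succ_of h, heat_succ, ← pairAvg_mul, mul_comm,
        ← pairAvg_const_mul]
      rw [← pairAvg_const (G := G) hG 1 x y, ← pairAvg_sub, pairAvg_const hG]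
      exact pairAvg_mono fun x' y' => by rw [mul_comm]; exact ih x' y'
    · rw [← add_assoc, stayProb_succ_of_not h, sub_zero]
      refine mul_le_one₀ (mul_le_one₀ (heat_le_one hG _ _ _) (heat_nonneg _ _ _)
        (heat_le_one hG _ _ _)) (sub_nonneg.2 (stayProb_le_one hG _ _ _ _)) ?_
      linarith [stayProb_nonneg (G := G) T (fun _ => S) a a]

variable (G) in
/-- The expected number of times before `T` at which two independent walks started at `o` are
both at `z`, up to the square of a ratio of degrees. -/
noncomputable def occupation (o : V) (T : ℕ) (z : V) : ℝ :=
  ∑ t ∈ Finset.range T, heat G o t z ^ 2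

/-- The occupation is subharmonic off `o`, by Jensen's inequality for the square. -/
theorem occupation_le_avg {o z : V} (h : z ≠ o) (T : ℕ) :
    occupation G o T z ≤ avg G (occupation G o T) z := by
  cases T with
  | zero => simp [occupation, avg]
  | succ T =>
    have h1 : occupation G o (T + 1) z = ∑ t ∈ Finset.range T, heat G o (t + 1) z ^ 2 := by
      rw [occupation, Finset.sum_range_succ', heat_zero, Set.indicator_of_notMem (by simpa using h)]
      simp
    have h2 : avg G (occupation G o (T + 1)) z =
        ∑ t ∈ Finset.range (T + 1), avg G (fun y => heat G o t y ^ 2) z :=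
      avg_sum _ (fun t y => heat G o t y ^ 2) z
    rw [h1, h2]
    refine (Finset.sum_le_sum fun t _ => ?_).trans (Finset.sum_le_sum_of_subset_of_nonneg
      (Finset.range_mono T.le_succ) fun t _ _ => avg_nonneg fun y => sq_nonneg _)
    rw [heat_succ]
    exact sq_avg_le _ _

end Occupation

section Teeth

variable {α : ℝ}

theorem occupation_vtx_succ_le (T : ℕ) (k : ℤ) (y : ℕ) :
    occupation (wedge α) (origin α) T (vtx α k (y + 1)) ≤
      occupation (wedge α) (origin α) T (vtx α k y) := by
  rcases le_total (height α k) y with h | h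
  · rw [vtx_of_le h, vtx_of_le (by omega)]
  · induction h using Nat.decreasingInduction with
    | self => rw [vtx_of_le (y := height α k + 1) (by omega)]
    | of_succ y hy ih =>
      have hne : vtx α k (y + 1) ≠ origin α := by
        rw [origin, Ne, vtx_inj hy (Nat.zero_le _)]; omega
      have h1 := occupation_le_avg (G := wedge α) hne T
      have h2 : 0 ≤ lap (wedge α) (occupation (wedge α) (origin α) T) (vtx α k (y + 1)) := by
        rw [lap_eq (G := wedge α) degree_pos]
        exact mul_nonneg (Nat.cast_nonneg _) (sub_nonneg.2 h1)
      rw [lap_vtx_succ _ hy] at h2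
      linarith

/-- Along a tooth the occupation decreases away from the backbone: it is convex there, with slope
zero at the tip. -/
theorem occupation_vtx_le (T : ℕ) (k : ℤ) (y : ℕ) :
    occupation (wedge α) (origin α) T (vtx α k y) ≤
      occupation (wedge α) (origin α) T (vtx α k 0) := by
  induction y with
  | zero => exact le_rfl
  | succ y ih => exact (occupation_vtx_succ_le T k y).trans ih

theorem heat_origin_pos (v : Wedge α) : ∃ n, 0 < heat (wedge α) (origin α) n v := by
  have step {v w : Wedge α} (hadj : (wedge α).Adj v w)
      (h : ∃ n, 0 < heat (wedge α) (origin α) n v) : ∃ n, 0 < heat (wedge α) (origin α) n w := by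
    obtain ⟨n, hn⟩ := h
    refine ⟨n + 1, ?_⟩
    rw [heat_succ]
    refine div_pos (Finset.sum_pos' (fun y _ => heat_nonneg _ _ _)
      ⟨v, ((wedge α).mem_neighborFinset w v).2 hadj.symm, hn⟩) (by exact_mod_cast degree_pos w)
  obtain ⟨x, y, hy, rfl⟩ := exists_eq_vtx v
  induction y with
  | zero =>
    induction x using Int.induction_on with
    | zero => exact ⟨0, by simp [heat_zero, origin]⟩
    | succ i ih => exact step (adj_vtx_right _) (ih (Nat.zero_le _))
    | pred i ih =>
      refine step (SimpleGraph.Adj.symm ?_) (ih (Nat.zero_le _))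
      simpa using adj_vtx_right (α := α) (-(i : ℤ) - 1)
  | succ y ih => exact step (adj_vtx_up hy) (ih (by omega))

/-- The Dirichlet potential of the segment `0 < y < R` of the tooth at `k`, extended by zero. If
the tooth is shorter than `R`, reflection at the tip leaves it subharmonic there. -/
noncomputable def toothPotential (k : ℤ) (R : ℕ) (z w : Wedge α) : ℝ :=
  if z.1.1 = k ∧ w.1.1 = k then max 0 (2 * (min (z.1.2 : ℝ) w.1.2 - z.1.2 * w.1.2 / R)) else 0

theorem toothPotential_nonneg (k : ℤ) (R : ℕ) (z w : Wedge α) : 0 ≤ toothPotential k R z w := by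
  unfold toothPotential; split_ifs <;> simp

theorem toothPotential_comm (k : ℤ) (R : ℕ) (z w : Wedge α) :
    toothPotential k R z w = toothPotential k R w z := by
  simp only [toothPotential, and_comm (a := z.1.1 = k), min_comm (z.1.2 : ℝ), mul_comm (z.1.2 : ℝ)]

theorem toothPotential_vtx (k : ℤ) (R : ℕ) {y v : ℕ} (hy : y ≤ height α k) (hv : v ≤ height α k) :
    toothPotential k R (vtx α k y) (vtx α k v) =
      max 0 (2 * (min (y : ℝ) v - y * v / R)) := by
  simp [toothPotential, vtx_snd hy, vtx_snd hv]

/-- The vertices of the segment `y < R` of the tooth at `k`. -/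
def InSegment (k : ℤ) (R : ℕ) (z : Wedge α) : Prop := z.1.1 = k ∧ z.1.2 < R

theorem lt_of_toothPotential_pos {y v R : ℕ} (hR : 0 < R)
    (h : 0 < 2 * (min (y : ℝ) v - y * v / R)) : 0 < v ∧ y < R := by
  have hR' : (0 : ℝ) < R := by exact_mod_cast hR
  have hv : 0 < v := by
    rcases Nat.eq_zero_or_pos v with rfl | hv
    · simp at h
    · exact hv
  refine ⟨hv, ?_⟩
  have hv' : (0 : ℝ) < v := by exact_mod_cast hv
  have h1 : (y : ℝ) * v / R < v := by linarith [min_le_right (y : ℝ) v]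
  rw [div_lt_iff₀ hR', mul_comm] at h1
  exact_mod_cast lt_of_mul_lt_mul_left h1 hv'.le

open Classical in
theorem lap_toothPotential (k : ℤ) {R : ℕ} (hR : 0 < R) (z w : Wedge α) :
    -(if z = w ∧ InSegment k R z then (2 : ℝ) else 0) ≤
      lap (wedge α) (toothPotential k R z) w := by
  have hR' : (0 : ℝ) < R := by exact_mod_cast hR
  have hm : -(if z = w ∧ InSegment k R z then (2 : ℝ) else 0) ≤ 0 := by
    split_ifs <;> norm_num
  rcases (toothPotential_nonneg k R z w).eq_or_lt with h0 | h0
  · refine hm.trans (Finset.sum_nonneg fun y _ => ?_)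
    rw [← h0, sub_zero]; exact toothPotential_nonneg _ _ _ _
  have hk : z.1.1 = k ∧ w.1.1 = k := by
    by_contra h; simp [toothPotential, h] at h0
  obtain ⟨k', y, hy, rfl⟩ := exists_eq_vtx z
  obtain ⟨l', v, hv, rfl⟩ := exists_eq_vtx w
  obtain rfl : k' = k := hk.1
  obtain rfl : l' = k' := hk.2
  rw [toothPotential_vtx _ R hy hv] at h0
  have h1 : 0 < 2 * (min (y : ℝ) v - y * v / R) := by
    by_contra! h; rw [max_eq_left h] at h0; exact lt_irrefl _ h0
  obtain ⟨hv0, hyR⟩ := lt_of_toothPotential_pos hR h1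
  obtain ⟨v, rfl⟩ : ∃ v', v = v' + 1 := ⟨v - 1, by omega⟩
  have hseg : InSegment l' R (vtx α l' y) := ⟨rfl, by rw [vtx_snd hy]; exact_mod_cast hyR⟩
  simp only [vtx_inj hy hv, hseg, and_true, true_and]
  rw [lap_vtx_succ _ hv, toothPotential_vtx _ R hy hv,
    toothPotential_vtx _ R hy (show v ≤ height α l' by omega), max_eq_right h1.le]
  have h2 := le_max_right 0 (2 * (min (y : ℝ) v - y * v / R))
  -- second difference of the minimum
  have hmin : -(if y = v + 1 then (1 : ℝ) else 0) ≤
      min (y : ℝ) v + min (y : ℝ) (v + 2 : ℕ) - 2 * min (y : ℝ) (v + 1 : ℕ) := by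
    have hz : -(if y = v + 1 then (1 : ℤ) else 0) ≤
        min (y : ℤ) v + min (y : ℤ) (v + 2 : ℕ) - 2 * min (y : ℤ) (v + 1 : ℕ) := by
      split_ifs <;> omega
    exact_mod_cast hz
  rcases eq_or_lt_of_le hv with hv' | hv'
  · rw [vtx_of_le (y := v + 2) (by omega), ← hv', toothPotential_vtx _ R hy hv, max_eq_right h1.le]
    have h3 : min (y : ℝ) (v + 2 : ℕ) = min (y : ℝ) (v + 1 : ℕ) := by
      norm_cast; omega
    have h4 : (y : ℝ) * v / R ≤ y * (v + 1 : ℕ) / R := by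
      push_cast; gcongr; linarith
    rw [h3] at hmin
    split_ifs at hmin ⊢ <;> linarith
  · rw [toothPotential_vtx _ R hy (show v + 2 ≤ height α l' by omega)]
    have h3 := le_max_right 0 (2 * (min (y : ℝ) (v + 2 : ℕ) - y * (v + 2 : ℕ) / R))
    have h4 : (y : ℝ) * v / R + y * (v + 2 : ℕ) / R = 2 * (y * (v + 1 : ℕ) / R) := by
      push_cast; ring
    split_ifs at hmin ⊢ <;> linarith

open Classical in
/-- The expected number of collisions in the segment before time `T`, with weight `2`, plus the
expected tooth potential at time `T`. -/
noncomputable def gain (k : ℤ) (R : ℕ) : ℕ → Wedge α → Wedge α → ℝ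
  | 0 => toothPotential k R
  | T + 1 => fun z w =>
      (if z = w ∧ InSegment k R z then 2 else 0) + pairAvg (wedge α) (gain k R T) z w

theorem toothPotential_le_gain (k : ℤ) {R : ℕ} (hR : 0 < R) (T : ℕ) {z w : Wedge α}
    (hzw : parity z = parity w) : toothPotential k R z w ≤ gain k R T z w := by
  classical
  induction T generalizing z w with
  | zero => exact le_rfl
  | succ T ih =>
    have h1 := sub_le_pairAvg_of_lap zero_le_two (toothPotential_comm k R)
      (lap_toothPotential k hR) hzw
    have h2 : pairAvg (wedge α) (toothPotential k R) z w ≤ pairAvg (wedge α) (gain k R T) z w :=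
      pairAvg_mono_of_adj fun z' w' hz hw => ih (by rw [parity_of_adj hz, parity_of_adj hw, hzw])
    rw [gain]
    linarith

/-- A collision in the middle part of the segment leads to many collisions in the segment. -/
theorem one_sub_stayProb_le_gain (k : ℤ) {ρ : ℕ} (hρ : 0 < ρ) (T : ℕ) {z w : Wedge α}
    (hzw : parity z = parity w) :
    ρ * (1 - stayProb (wedge α) T
      (fun _ x y => ¬ (x = y ∧ x.1.1 = k ∧ (ρ : ℤ) ≤ x.1.2 ∧ x.1.2 ≤ 2 * ρ)) z w) ≤
        gain k (4 * ρ) T z w := by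
  classical
  have hρ' : (0 : ℝ) < ρ := by exact_mod_cast hρ
  induction T generalizing z w with
  | zero => simpa [stayProb, gain] using toothPotential_nonneg k (4 * ρ) z w
  | succ T ih =>
    by_cases h : z = w ∧ z.1.1 = k ∧ (ρ : ℤ) ≤ z.1.2 ∧ z.1.2 ≤ 2 * ρ
    · rw [stayProb_succ_of_not (by simpa using h), sub_zero, mul_one]
      refine le_trans ?_ (toothPotential_le_gain k (by omega) (T + 1) hzw)
      obtain ⟨rfl, hk, h1, h2⟩ := h
      have h1' : (ρ : ℝ) ≤ z.1.2 := by exact_mod_cast h1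
      have h2' : (z.1.2 : ℝ) ≤ 2 * ρ := by exact_mod_cast h2
      rw [toothPotential, if_pos ⟨hk, hk⟩]
      refine le_trans ?_ (le_max_right _ _)
      rw [min_self]
      have : (z.1.2 : ℝ) * z.1.2 / (4 * ρ : ℕ) ≤ z.1.2 / 2 := by
        push_cast
        rw [div_le_div_iff₀ (by positivity) (by norm_num)]
        nlinarith
      linarith
    · rw [stayProb_succ_of h, gain]
      have h1 : (0 : ℝ) ≤ if z = w ∧ InSegment k (4 * ρ) z then 2 else 0 := by
        split_ifs <;> norm_num
      have h2 : pairAvg (wedge α) (fun z w => ρ * (1 - stayProb (wedge α) T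
          (fun _ x y => ¬ (x = y ∧ x.1.1 = k ∧ (ρ : ℤ) ≤ x.1.2 ∧ x.1.2 ≤ 2 * ρ)) z w)) z w ≤
            pairAvg (wedge α) (gain k (4 * ρ) T) z w :=
        pairAvg_mono_of_adj fun z' w' hz hw => ih (by rw [parity_of_adj hz, parity_of_adj hw, hzw])
      rw [pairAvg_const_mul, pairAvg_sub, pairAvg_const degree_pos] at h2
      linarith

open Classical in
/-- The segment as a finite set. -/
noncomputable def segment (α : ℝ) (k : ℤ) (R : ℕ) : Finset (Wedge α) :=
  (Finset.range R).image (vtx α k)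

theorem mem_segment {k : ℤ} {R : ℕ} {z : Wedge α} (h : InSegment k R z) : z ∈ segment α k R := by
  obtain ⟨x, y, hy, rfl⟩ := exists_eq_vtx z
  obtain ⟨rfl, h2⟩ := h
  rw [vtx_snd hy] at h2
  exact Finset.mem_image.2 ⟨y, Finset.mem_range.2 (by exact_mod_cast h2), rfl⟩

theorem sum_segment_le {k : ℤ} {R : ℕ} {f : Wedge α → ℝ} {c : ℝ} (hf : ∀ y, f (vtx α k y) ≤ c)
    (hc : 0 ≤ c) : ∑ z ∈ segment α k R, f z ≤ R * c := by
  have h1 : ∑ z ∈ segment α k R, f z ≤ (segment α k R).card • c := by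
    refine Finset.sum_le_card_nsmul _ _ _ fun z hz => ?_
    obtain ⟨y, -, rfl⟩ := Finset.mem_image.1 hz
    exact hf y
  rw [nsmul_eq_mul] at h1
  refine h1.trans (mul_le_mul_of_nonneg_right ?_ hc)
  exact_mod_cast Finset.card_image_le.trans_eq (Finset.card_range R)

/-- The collisions are summed vertex by vertex, and the potential, at most `2 * R` on the segment,
is bounded through the position of the first walk. -/
theorem gain_le (k : ℤ) {R : ℕ} (hR : 0 < R) (T : ℕ) (x y : Wedge α) :
    gain k R T x y ≤ 2 * ∑ z ∈ segment α k R, ∑ t ∈ Finset.range T,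
        heat (wedge α) z t x * heat (wedge α) z t y +
      2 * R * ∑ z ∈ segment α k R, heat (wedge α) z T x := by
  classical
  induction T generalizing x y with
  | zero =>
    have hs : 0 ≤ ∑ z ∈ segment α k R, heat (wedge α) z 0 x :=
      Finset.sum_nonneg fun _ _ => heat_nonneg _ _ _
    simp only [Finset.range_zero, Finset.sum_empty, Finset.sum_const_zero, mul_zero, zero_add, gain]
    rcases (toothPotential_nonneg k R x y).eq_or_lt with h0 | h0
    · rw [← h0]; positivity
    have hk : x.1.1 = k ∧ y.1.1 = k := by
      by_contra h; simp [toothPotential, h] at h0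
    obtain ⟨k', u, hu, rfl⟩ := exists_eq_vtx x
    obtain ⟨l', v, hv, rfl⟩ := exists_eq_vtx y
    obtain rfl : k' = k := hk.1
    obtain rfl : l' = k' := hk.2
    rw [toothPotential_vtx _ R hu hv] at h0 ⊢
    have h1 : 0 < 2 * (min (u : ℝ) v - u * v / R) := by
      by_contra! h; rw [max_eq_left h] at h0; exact lt_irrefl _ h0
    obtain ⟨hv0, hyR⟩ := lt_of_toothPotential_pos hR h1
    rw [max_eq_right h1.le]
    have h2 : heat (wedge α) (vtx α l' u) 0 (vtx α l' u) ≤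
        ∑ z ∈ segment α l' R, heat (wedge α) z 0 (vtx α l' u) :=
      Finset.single_le_sum (f := fun z => heat (wedge α) z 0 (vtx α l' u))
        (fun _ _ => heat_nonneg _ _ _)
        (mem_segment ⟨rfl, by rw [vtx_snd hu]; exact_mod_cast hyR⟩)
    have h3 : heat (wedge α) (vtx α l' u) 0 (vtx α l' u) = 1 := by simp [heat_zero]
    have h4 : (u : ℝ) ≤ R := by exact_mod_cast hyR.le
    have h5 := min_le_left (u : ℝ) v
    have h6 : 0 ≤ (u : ℝ) * v / R := by positivity
    rw [h3] at h2
    nlinarith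
  | succ T ih =>
    have h1 : (if x = y ∧ InSegment k R x then (2 : ℝ) else 0) ≤
        2 * ∑ z ∈ segment α k R, heat (wedge α) z 0 x * heat (wedge α) z 0 y := by
      have hn (z : Wedge α) : 0 ≤ heat (wedge α) z 0 x * heat (wedge α) z 0 y :=
        mul_nonneg (heat_nonneg _ _ _) (heat_nonneg _ _ _)
      split_ifs with h
      · obtain ⟨rfl, h⟩ := h
        have := Finset.single_le_sum (f := fun z => heat (wedge α) z 0 x * heat (wedge α) z 0 x)
          (fun z _ => hn z) (mem_segment h)
        simp only [heat_zero, Set.indicator_of_mem (Set.mem_singleton x), Pi.one_apply,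
          mul_one] at this ⊢
        linarith
      · exact mul_nonneg zero_le_two (Finset.sum_nonneg fun z _ => hn z)
    have h2 : pairAvg (wedge α) (gain k R T) x y ≤ _ := pairAvg_mono fun x' y' => ih x' y'
    have h3 : pairAvg (wedge α) (fun x y => 2 * ∑ z ∈ segment α k R, ∑ t ∈ Finset.range T,
        heat (wedge α) z t x * heat (wedge α) z t y +
          2 * R * ∑ z ∈ segment α k R, heat (wedge α) z T x) x y =
        2 * ∑ z ∈ segment α k R, ∑ t ∈ Finset.range T,
          heat (wedge α) z (t + 1) x * heat (wedge α) z (t + 1) y +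
        2 * R * ∑ z ∈ segment α k R, heat (wedge α) z (T + 1) x := by
      rw [pairAvg_add, pairAvg_const_mul, pairAvg_const_mul]
      congr 2
      · simp only [pairAvg, avg_sum, avg_const_mul, avg_mul_const, heat_succ]
      · simp only [pairAvg, avg_sum, avg_const degree_pos, heat_succ]
    rw [h3] at h2
    simp only [gain, Finset.sum_range_succ', Finset.sum_add_distrib, mul_add]
    linarith

theorem heat_origin_le (z : Wedge α) (t : ℕ) :
    heat (wedge α) z t (origin α) ≤ 3 * heat (wedge α) (origin α) t z := by
  have h := degree_mul_heat (G := wedge α) degree_pos (origin α) z t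
  have h1 : (1 : ℝ) ≤ (wedge α).degree (origin α) := by exact_mod_cast degree_pos _
  have h3 : ((wedge α).degree z : ℝ) ≤ 3 := by exact_mod_cast degree_le_three _
  have h4 := heat_nonneg (G := wedge α) (origin α) t z
  have h5 := heat_nonneg (G := wedge α) z t (origin α)
  nlinarith

/-- The probability of a collision in a dyadic box of the tooth at `k` is bounded by the occupation
at the bottom of the tooth, whatever the scale of the box. -/
theorem one_sub_stayProb_le {k : ℤ} {ρ : ℕ} (hρ : 0 < ρ) {q : ℝ}
    (hq : ∀ T, occupation (wedge α) (origin α) T (vtx α k 0) ≤ q) (T : ℕ) :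
    1 - stayProb (wedge α) T
      (fun _ x y => ¬ (x = y ∧ x.1.1 = k ∧ (ρ : ℤ) ≤ x.1.2 ∧ x.1.2 ≤ 2 * ρ)) (origin α) (origin α) ≤
        72 * q := by
  have hρ' : (0 : ℝ) < ρ := by exact_mod_cast hρ
  have hocc (y T : ℕ) : occupation (wedge α) (origin α) T (vtx α k y) ≤ q :=
    (occupation_vtx_le T k y).trans (hq T)
  have hq0 : 0 ≤ q := by simpa [occupation] using hq 0
  have hlim (y : ℕ) : Filter.Tendsto (fun t => heat (wedge α) (origin α) t (vtx α k y))
      Filter.atTop (nhds 0) := by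
    have h1 : Summable fun t => heat (wedge α) (origin α) t (vtx α k y) ^ 2 :=
      summable_of_sum_range_le (fun _ => sq_nonneg _) (hocc y)
    have h2 := (Real.continuous_sqrt.tendsto _).comp h1.tendsto_atTop_zero
    simpa [Function.comp_def, Real.sqrt_sq, heat_nonneg] using h2
  have hsum : Filter.Tendsto (fun t => ∑ z ∈ segment α k (4 * ρ), heat (wedge α) (origin α) t z)
      Filter.atTop (nhds 0) := by
    rw [← Finset.sum_const_zero (ι := Wedge α) (s := segment α k (4 * ρ))]
    refine tendsto_finsetSum _ fun z hz => ?_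
    obtain ⟨y, -, rfl⟩ := Finset.mem_image.1 hz
    exact hlim y
  set S : Wedge α → Wedge α → Prop :=
    fun x y => ¬ (x = y ∧ x.1.1 = k ∧ (ρ : ℤ) ≤ x.1.2 ∧ x.1.2 ≤ 2 * ρ) with hS
  have hanti : Antitone fun T => stayProb (wedge α) T (fun _ => S) (origin α) (origin α) :=
    antitone_nat_of_succ_le fun T => stayProb_succ_le degree_pos T _ _ _
  have key : ∀ T' ≥ T, 1 - stayProb (wedge α) T (fun _ => S) (origin α) (origin α) ≤
      72 * q + 24 * ∑ z ∈ segment α k (4 * ρ), heat (wedge α) (origin α) T' z := by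
    intro T' hT'
    have h1 := one_sub_stayProb_le_gain k hρ T' (rfl : parity (origin α) = parity (origin α))
    have h2 := gain_le k (show 0 < 4 * ρ by omega) T' (origin α) (origin α)
    have h3 := hanti hT'
    have h4 : ∑ z ∈ segment α k (4 * ρ), ∑ t ∈ Finset.range T',
        heat (wedge α) z t (origin α) * heat (wedge α) z t (origin α) ≤
          (4 * ρ : ℕ) * (9 * q) := by
      refine sum_segment_le (fun y => ?_) (by positivity)
      refine le_trans ?_ (mul_le_mul_of_nonneg_left (hocc y T') (by norm_num))
      rw [occupation, Finset.mul_sum]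
      refine Finset.sum_le_sum fun t _ => ?_
      have h5 := heat_origin_le (vtx α k y) t
      have h6 := heat_nonneg (G := wedge α) (vtx α k y) t (origin α)
      nlinarith
    have h5 : ∑ z ∈ segment α k (4 * ρ), heat (wedge α) z T' (origin α) ≤
        3 * ∑ z ∈ segment α k (4 * ρ), heat (wedge α) (origin α) T' z := by
      rw [Finset.mul_sum]
      exact Finset.sum_le_sum fun z _ => heat_origin_le z T'
    push_cast at h2 h4
    refine le_of_mul_le_mul_left ?_ hρ'
    have h6 := mul_le_mul_of_nonneg_left h5 hρ'.le
    have h7 := mul_le_mul_of_nonneg_left h3 hρ'.le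
    simp only at h3 h7
    linarith
  have hlim2 := (hsum.const_mul 24).const_add (72 * q)
  rw [mul_zero, add_zero] at hlim2
  exact ge_of_tendsto hlim2 (Filter.eventually_atTop.2 ⟨T, key⟩)

end Teeth

/-! ### Finitely many collisions when `1 < α` -/

section Events

variable {V : Type*} {G : SimpleGraph V} [G.LocallyFinite]

theorem stayProb_single_time (hG : ∀ x, 0 < G.degree x) (z : V) (t : ℕ) (x y : V) :
    stayProb G (t + 1) (fun s x y => s = t → x = z ∧ y = z) x y =
      heat G z t x * heat G z t y := by
  induction t generalizing x y with
  | zero =>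
    by_cases h : x = z ∧ y = z
    · rw [stayProb_succ_of fun _ => h, h.1, h.2]
      simp [stayProb, heat_zero, pairAvg_const hG]
    · rw [stayProb_succ_of_not fun h' => h (h' rfl)]
      rw [not_and_or] at h
      rcases h with h | h <;> simp [heat_zero, h]
  | succ t ih =>
    rw [stayProb_succ_of (by simp), heat_succ, ← pairAvg_mul]
    simp only [add_left_inj]
    congr 1
    funext x y
    exact ih x y

variable [MeasurableSpace V] [DiscreteMeasurableSpace V] [Countable V]

theorem pairLaw_meet_at (hG : ∀ x, 0 < G.degree x) (a z : V) (t : ℕ) :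
    pairLaw G a a {ω | ω.1 t = z ∧ ω.2 t = z} = ENNReal.ofReal (heat G z t a ^ 2) := by
  rw [sq, ← stayProb_single_time hG, ← pairLaw_forall_lt hG]
  congr 1
  ext ω
  refine ⟨fun h s _ e => by rw [e]; exact h, fun h => h t t.lt_succ_self rfl⟩

theorem pairLaw_exists_le (hG : ∀ x, 0 < G.degree x) (a b : V) (S : V → V → Prop) {c : ℝ}
    (h : ∀ T, 1 - stayProb G T (fun _ => S) a b ≤ c) :
    pairLaw G a b {ω | ∃ t, ¬ S (ω.1 t) (ω.2 t)} ≤ ENNReal.ofReal c := by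
  have hmS (t : ℕ) : MeasurableSet {ω : (ℕ → V) × (ℕ → V) | S (ω.1 t) (ω.2 t)} := by
    have h2 : Measurable fun ω : (ℕ → V) × (ℕ → V) => (ω.1 t, ω.2 t) := by fun_prop
    exact h2 (MeasurableSet.of_discrete (s := {p : V × V | S p.1 p.2}))
  have hmC (T : ℕ) : MeasurableSet {ω : (ℕ → V) × (ℕ → V) | ∀ t < T, S (ω.1 t) (ω.2 t)} := by
    simp only [Set.ofPred_forall]
    exact MeasurableSet.iInter fun t => MeasurableSet.iInter fun _ => hmS t
  have hU : {ω : (ℕ → V) × (ℕ → V) | ∃ t, ¬ S (ω.1 t) (ω.2 t)} =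
      ⋃ T : ℕ, {ω | ∀ t < T, S (ω.1 t) (ω.2 t)}ᶜ := by
    ext ω
    simp only [Set.mem_iUnion, Set.mem_compl_iff, Set.mem_ofPred_eq, not_forall]
    exact ⟨fun ⟨t, ht⟩ => ⟨t + 1, t, t.lt_succ_self, ht⟩, fun ⟨_, t, _, ht⟩ => ⟨t, ht⟩⟩
  have hmono : Monotone fun T : ℕ =>
      {ω : (ℕ → V) × (ℕ → V) | ∀ t < T, S (ω.1 t) (ω.2 t)}ᶜ :=
    fun T T' hT => Set.compl_subset_compl.2 fun ω hω t ht => hω t (ht.trans_le hT)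
  rw [hU, hmono.measure_iUnion]
  refine iSup_le fun T => ?_
  rw [prob_compl_eq_one_sub (hmC T), pairLaw_forall_lt hG a b (fun _ => S), ← ENNReal.ofReal_one,
    ← ENNReal.ofReal_sub _ (stayProb_nonneg _ _ _ _)]
  exact ENNReal.ofReal_le_ofReal (h T)

end Events

section Transience

variable {α : ℝ}

/-- The number of dyadic boxes in a tooth grows more slowly than any power of its position. -/
theorem exists_size_height_le (hα : 0 < α) {ε : ℝ} (hε : 0 < ε) :
    ∃ C : ℝ, 0 ≤ C ∧ ∀ (k : ℤ) (n : ℕ), 1 ≤ n → |k| ≤ n →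
      ((height α k).size + 1 : ℝ) ≤ C * (n : ℝ) ^ ε := by
  have hlog : 0 < Real.log 2 := Real.log_pos one_lt_two
  set δ := ε / α with hδ
  have hδ0 : 0 < δ := by positivity
  refine ⟨2 + 1 / (δ * Real.log 2), by positivity, fun k n hn hk => ?_⟩
  have hn1 : (1 : ℝ) ≤ n := by exact_mod_cast hn
  have hp : 1 ≤ (n : ℝ) ^ ε := Real.one_le_rpow hn1 hε.le
  suffices h : ((height α k).size : ℝ) - 1 ≤ 1 / (δ * Real.log 2) * (n : ℝ) ^ ε by linarith
  rcases Nat.eq_zero_or_pos (height α k) with h0 | h0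
  · rw [h0, Nat.size_zero]
    have : 0 ≤ 1 / (δ * Real.log 2) * (n : ℝ) ^ ε := by positivity
    push_cast; linarith
  have hj : 0 < (height α k).size := Nat.size_pos.2 h0
  obtain ⟨j, hj'⟩ : ∃ j, (height α k).size = j + 1 := ⟨_, (Nat.succ_pred_eq_of_pos hj).symm⟩
  have h1 : 2 ^ j ≤ height α k := Nat.lt_size.1 (by omega)
  have hkn : |(k : ℝ)| ≤ n := by exact_mod_cast hk
  have h2 : (2 : ℝ) ^ j ≤ (n : ℝ) ^ α := by
    have h3 : ((2 ^ j : ℕ) : ℝ) ≤ height α k := by exact_mod_cast h1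
    push_cast at h3
    exact h3.trans ((Nat.floor_le (powerProfile_nonneg α k)).trans
      (Real.rpow_le_rpow (abs_nonneg _) hkn hα.le))
  have h3 : (j : ℝ) * Real.log 2 ≤ (n : ℝ) ^ ε / δ := by
    rw [← Real.log_pow]
    refine (Real.log_le_log (by positivity) h2).trans
      ((Real.log_le_rpow_div (by positivity) hδ0).trans_eq ?_)
    rw [← Real.rpow_mul (by positivity), hδ, mul_div_cancel₀ _ hα.ne']
  rw [hj']
  push_cast
  rw [add_sub_cancel_right, one_div_mul_eq_div, div_mul_eq_div_div, le_div_iff₀ hlog]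
  exact h3

theorem heat_origin_eq_zero {t : ℕ} {x : Wedge α} (h : (t : ℤ) < |x.1.1|) :
    heat (wedge α) (origin α) t x = 0 := by
  induction t generalizing x with
  | zero =>
    rw [heat_zero, Set.indicator_of_notMem]
    rintro rfl
    simp [origin] at h
  | succ t ih =>
    rw [heat_succ, ← avg_const (G := wedge α) degree_pos 0 x]
    refine avg_congr_of_adj fun y hy => ih ?_
    rw [wedge_adj_iff] at hy
    simp only [abs_eq_max_neg] at *
    push_cast at h
    omega

/-- The expected number of collisions on the backbone is finite, even with a weight for the number
of dyadic boxes in the tooth. -/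
theorem tsum_size_mul_tsum_heat_sq_ne_top (hα : 1 < α) :
    ∑' k : ℤ, (((height α k).size + 1 : ℕ) : ENNReal) *
      ∑' t : ℕ, ENNReal.ofReal (heat (wedge α) (origin α) t (vtx α k 0) ^ 2) ≠ ⊤ := by
  set β := min α 2 with hβ
  have hβ1 : 1 < β := lt_min hα one_lt_two
  set γ := (1 + 2 * β) / (2 + β) with hγ
  have hγ1 : 1 < γ := by rw [hγ, lt_div_iff₀ (by linarith)]; linarith
  set ε := (γ - 1) / 2 with hε
  have hε0 : 0 < ε := by rw [hε]; linarith
  obtain ⟨C, hC0, hC⟩ := exists_size_height_le (α := α) (by linarith) hε0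
  set r : ℕ → ℝ := fun m => C * ((2 * m + 1 : ℕ) : ℝ) ^ ε *
    ∑ k ∈ Finset.Icc (-(2 * m + 1 : ℕ) : ℤ) (2 * m + 1 : ℕ),
      heatPair (wedge α) (origin α) (2 * m) (vtx α k 0) ^ 2 with hr
  have hr0 (m : ℕ) : 0 ≤ r m :=
    mul_nonneg (by positivity) (Finset.sum_nonneg fun _ _ => sq_nonneg _)
  have hrs : Summable r := by
    rw [← summable_nat_add_iff 1]
    have hs : Summable fun m : ℕ => (C * 3 ^ ε * 30000) * ((m + 1 : ℕ) : ℝ) ^ (ε - γ) :=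
      ((summable_nat_add_iff 1).2 (Real.summable_nat_rpow.2 (by rw [hε]; linarith))).mul_left _
    refine Summable.of_nonneg_of_le (fun m => hr0 _) (fun m => ?_) hs
    have hM : (0 : ℝ) < (m + 1 : ℕ) := by positivity
    have h1 := sum_sq_heatPair_le_rpow hβ1 (min_le_left _ _) (min_le_right α 2)
      (Nat.le_add_left 1 m) (Finset.Icc (-(2 * (m + 1) + 1 : ℕ) : ℤ) (2 * (m + 1) + 1 : ℕ))
    have h2 : ((2 * (m + 1) + 1 : ℕ) : ℝ) ^ ε ≤ 3 ^ ε * ((m + 1 : ℕ) : ℝ) ^ ε := by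
      rw [← Real.mul_rpow (by norm_num) hM.le]
      refine Real.rpow_le_rpow (by positivity) ?_ hε0.le
      push_cast; linarith
    calc r (m + 1) ≤ C * (3 ^ ε * ((m + 1 : ℕ) : ℝ) ^ ε) *
          (30000 * ((m + 1 : ℕ) : ℝ) ^ (-γ)) := by
            refine mul_le_mul (mul_le_mul_of_nonneg_left h2 hC0) h1
              (Finset.sum_nonneg fun _ _ => sq_nonneg _) (by positivity)
      _ = (C * 3 ^ ε * 30000) * ((m + 1 : ℕ) : ℝ) ^ (ε - γ) := by
            rw [sub_eq_add_neg, Real.rpow_add hM]; ring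
  have hfin : ∑' m, ENNReal.ofReal (r m) ≠ ⊤ := by
    rw [← ENNReal.ofReal_tsum_of_nonneg hr0 hrs]; exact ENNReal.ofReal_ne_top
  set c : ℕ → ENNReal := fun t => ∑' k : ℤ, (((height α k).size + 1 : ℕ) : ENNReal) *
    ENNReal.ofReal (heat (wedge α) (origin α) t (vtx α k 0) ^ 2) with hc
  have hcr (m t : ℕ) (ht : t ≤ 2 * m + 1) (hle : ∀ x, heat (wedge α) (origin α) t x ≤
      heatPair (wedge α) (origin α) (2 * m) x) : c t ≤ ENNReal.ofReal (r m) := by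
    simp only [hc, hr]
    rw [tsum_eq_sum (s := Finset.Icc (-(2 * m + 1 : ℕ) : ℤ) (2 * m + 1 : ℕ)), Finset.mul_sum,
      ENNReal.ofReal_sum_of_nonneg fun k _ => mul_nonneg (by positivity) (sq_nonneg _)]
    · refine Finset.sum_le_sum fun k hk => ?_
      rw [ENNReal.ofReal_mul (by positivity)]
      refine mul_le_mul' ?_ (ENNReal.ofReal_le_ofReal
        (pow_le_pow_left₀ (heat_nonneg _ _ _) (hle _) 2))
      rw [← ENNReal.ofReal_natCast]
      refine ENNReal.ofReal_le_ofReal ?_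
      push_cast
      exact_mod_cast hC k (2 * m + 1) (by omega) (abs_le.2 (Finset.mem_Icc.1 hk))
    · intro k hk
      rw [heat_origin_eq_zero]
      · simp
      · rw [vtx_fst]
        by_contra! h
        exact hk (Finset.mem_Icc.2 (abs_le.1 (h.trans (by exact_mod_cast ht))))
  have hsum : ∑' k : ℤ, (((height α k).size + 1 : ℕ) : ENNReal) *
      ∑' t : ℕ, ENNReal.ofReal (heat (wedge α) (origin α) t (vtx α k 0) ^ 2) = ∑' t, c t := by
    simp only [hc, ← ENNReal.tsum_mul_left]
    exact ENNReal.tsum_comm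
  rw [hsum, ← tsum_even_add_odd ENNReal.summable ENNReal.summable]
  refine ENNReal.add_ne_top.2 ⟨ne_top_of_le_ne_top hfin (ENNReal.tsum_le_tsum fun m => ?_),
    ne_top_of_le_ne_top hfin (ENNReal.tsum_le_tsum fun m => ?_)⟩
  · exact hcr m _ (by omega) fun x => le_add_of_nonneg_right (heat_nonneg _ _ _)
  · exact hcr m _ le_rfl fun x => le_add_of_nonneg_left (heat_nonneg _ _ _)

theorem finiteCollisionProperty_of_one_lt (hα : 1 < α) : FiniteCollisionProperty (wedge α) := by
  intro a
  -- `p` is the probability that the walk from the origin is at `a` at time `n`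
  obtain ⟨n, hp⟩ : ∃ n, 0 < heat (wedge α) a n (origin α) := by
    obtain ⟨n, hn⟩ := heat_origin_pos a
    refine ⟨n, ?_⟩
    have h1 := degree_mul_heat (G := wedge α) degree_pos (origin α) a n
    have h2 : (0 : ℝ) < (wedge α).degree a := by exact_mod_cast degree_pos a
    exact pos_of_mul_pos_right (h1 ▸ mul_pos h2 hn) (Nat.cast_nonneg _)
  set p := heat (wedge α) a n (origin α) with hpdef
  set Q : ℤ → ENNReal := fun k =>
    ∑' t : ℕ, ENNReal.ofReal (heat (wedge α) (origin α) t (vtx α k 0) ^ 2) with hQ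
  have hsum : ∑' k : ℤ, (((height α k).size + 1 : ℕ) : ENNReal) * Q k ≠ ⊤ :=
    tsum_size_mul_tsum_heat_sq_ne_top hα
  have hQfin (k : ℤ) : Q k ≠ ⊤ := by
    refine ne_top_of_le_ne_top (ENNReal.ne_top_of_tsum_ne_top hsum k) ?_
    exact le_mul_of_one_le_left zero_le (by exact_mod_cast Nat.le_add_left 1 _)
  have hocc (k : ℤ) (T : ℕ) :
      occupation (wedge α) (origin α) T (vtx α k 0) ≤ (Q k).toReal := by
    refine (ENNReal.ofReal_le_iff_le_toReal (hQfin k)).1 ?_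
    rw [occupation, ENNReal.ofReal_sum_of_nonneg fun _ _ => sq_nonneg _]
    exact ENNReal.sum_le_tsum _
  have hz (k : ℤ) (y : ℕ) :
      ∑' t : ℕ, ENNReal.ofReal (heat (wedge α) (origin α) t (vtx α k y) ^ 2) ≤ Q k := by
    refine ENNReal.tsum_le_of_sum_range_le fun T => ?_
    rw [← ENNReal.ofReal_sum_of_nonneg fun _ _ => sq_nonneg _]
    exact (ENNReal.ofReal_le_iff_le_toReal (hQfin k)).2
      ((occupation_vtx_le T k y).trans (hocc k T))
  have hmeet (k : ℤ) (y : ℕ) :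
      ∑' t : ℕ, pairLaw (wedge α) a a {ω | ω.1 t = vtx α k y ∧ ω.2 t = vtx α k y} ≤
        ENNReal.ofReal (72 / p ^ 2) * Q k := by
    refine le_trans ?_ (mul_le_mul_right (hz k y) _)
    rw [← ENNReal.tsum_mul_left]
    refine le_trans (ENNReal.tsum_le_tsum fun t => ?_)
      (ENNReal.tsum_comp_le_tsum_of_injective (add_left_injective n) _)
    rw [pairLaw_meet_at degree_pos, ← ENNReal.ofReal_mul (by positivity)]
    refine ENNReal.ofReal_le_ofReal ?_
    have h1 := (heat_mul_heat_le (G := wedge α) a (vtx α k y) n t (origin α)).trans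
      (heat_origin_le _ _)
    rw [← hpdef] at h1
    have h2 := pow_le_pow_left₀ (mul_nonneg hp.le (heat_nonneg _ _ _)) h1 2
    rw [div_mul_eq_mul_div, le_div_iff₀ (by positivity)]
    nlinarith [sq_nonneg (heat (wedge α) (origin α) (t + n) (vtx α k y))]
  -- boxes are indexed by the tooth and the binary length of the height; length `0` is the bottom
  set E : ℤ × ℕ → Set ((ℕ → Wedge α) × (ℕ → Wedge α)) := fun i =>
    {ω | ∃ t, ω.1 t = ω.2 t ∧ (ω.1 t).1.1 = i.1 ∧ (ω.1 t).1.2.toNat.size = i.2} with hE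
  have hEle (k : ℤ) (j : ℕ) : pairLaw (wedge α) a a (E (k, j)) ≤
      ENNReal.ofReal (72 / p ^ 2) * Q k := by
    rcases Nat.eq_zero_or_pos j with rfl | hj
    · refine le_trans ?_ (hmeet k 0)
      refine le_trans (measure_mono ?_) (measure_iUnion_le _)
      rintro ω ⟨t, h1, h2, h3⟩
      obtain ⟨x, y, hy, hv⟩ := exists_eq_vtx (ω.1 t)
      rw [Nat.size_eq_zero, hv, vtx_snd hy, Int.toNat_natCast] at h3
      rw [hv] at h2
      obtain rfl : x = k := h2
      subst h3
      exact Set.mem_iUnion.2 ⟨t, hv, h1 ▸ hv⟩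
    · have hρ : 0 < 2 ^ (j - 1) := by positivity
      have h1 (T : ℕ) : 1 - stayProb (wedge α) T (fun _ x y => ¬ (x = y ∧ x.1.1 = k ∧
          ((2 ^ (j - 1) : ℕ) : ℤ) ≤ x.1.2 ∧ x.1.2 ≤ 2 * (2 ^ (j - 1) : ℕ))) a a ≤
            72 / p ^ 2 * (Q k).toReal := by
        have h2 := heat_mul_one_sub_stayProb_le (G := wedge α) degree_pos
          (fun x y => ¬ (x = y ∧ x.1.1 = k ∧
          ((2 ^ (j - 1) : ℕ) : ℤ) ≤ x.1.2 ∧ x.1.2 ≤ 2 * (2 ^ (j - 1) : ℕ))) a T n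
          (origin α) (origin α)
        have h3 := h2.trans (one_sub_stayProb_le hρ (hocc k) (T + n))
        rw [← hpdef] at h3
        rw [div_mul_eq_mul_div, le_div_iff₀ (by positivity)]
        linarith
      have h2 := pairLaw_exists_le degree_pos a a _ h1
      rw [ENNReal.ofReal_mul (by positivity), ENNReal.ofReal_toReal (hQfin k)] at h2
      refine (measure_mono ?_).trans h2
      rintro ω ⟨t, h1, h2, h3⟩
      refine ⟨t, not_not.2 ⟨h1, h2, ?_⟩⟩
      have h0 : 0 ≤ (ω.1 t).1.2 := (ω.1 t).2.1
      simp only at h3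
      have h4 : 2 ^ (j - 1) ≤ (ω.1 t).1.2.toNat := Nat.lt_size.1 (by omega)
      have h5 : (ω.1 t).1.2.toNat < 2 ^ j := Nat.size_le.1 h3.le
      have h6 : 2 ^ j = 2 * 2 ^ (j - 1) := by
        rw [← pow_succ']; congr 1; omega
      rw [h6] at h5
      constructor <;> omega
  have hEempty (k : ℤ) (j : ℕ) (hj : (height α k).size < j) :
      pairLaw (wedge α) a a (E (k, j)) = 0 := by
    convert measure_empty (μ := pairLaw (wedge α) a a)
    refine Set.eq_empty_of_forall_notMem ?_
    rintro ω ⟨t, -, h2, h3⟩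
    obtain ⟨x, y, hy, hv⟩ := exists_eq_vtx (ω.1 t)
    rw [hv, vtx_snd hy, Int.toNat_natCast] at h3
    rw [hv] at h2
    obtain rfl : x = k := h2
    have := Nat.size_le_size hy
    simp only at h3
    omega
  have hEsum : ∑' i, pairLaw (wedge α) a a (E i) ≠ ⊤ := by
    rw [ENNReal.tsum_prod']
    have h1 : ∑' k : ℤ, ENNReal.ofReal (72 / p ^ 2) *
        ((((height α k).size + 1 : ℕ) : ENNReal) * Q k) ≠ ⊤ := by
      rw [ENNReal.tsum_mul_left]; exact ENNReal.mul_ne_top ENNReal.ofReal_ne_top hsum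
    refine ne_top_of_le_ne_top h1 (ENNReal.tsum_le_tsum fun k => ?_)
    rw [tsum_eq_sum (s := Finset.range ((height α k).size + 1)) fun j hj =>
      hEempty k j (by simpa using hj)]
    refine (Finset.sum_le_card_nsmul _ _ _ fun j _ => hEle k j).trans_eq ?_
    rw [Finset.card_range, nsmul_eq_mul]; ring
  have hfinE := ae_finite_setOfPred_mem hEsum
  have hfinz : ∀ z : Wedge α, ∀ᵐ ω ∂(pairLaw (wedge α) a a),
      {t : ℕ | ω.1 t = z ∧ ω.2 t = z}.Finite := by
    intro z
    obtain ⟨k, y, -, rfl⟩ := exists_eq_vtx z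
    exact ae_finite_setOfPred_mem (ne_top_of_le_ne_top
      (ENNReal.mul_ne_top ENNReal.ofReal_ne_top (hQfin k)) (hmeet k y))
  filter_upwards [hfinE, ae_all_iff.2 hfinz] with ω h1 h2
  rw [collisions, Set.encard_lt_top_iff]
  have hbox (i : ℤ × ℕ) : {z : Wedge α | z.1.1 = i.1}.Finite := by
    refine ((Set.finite_Iic (height α i.1)).image (vtx α i.1)).subset ?_
    intro z hz
    obtain ⟨k, y, hy, rfl⟩ := exists_eq_vtx z
    obtain rfl : k = i.1 := hz
    exact ⟨y, hy, rfl⟩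
  refine (h1.biUnion fun i _ => (hbox i).biUnion fun z _ => h2 z).subset fun t ht => ?_
  simp only [Set.mem_iUnion]
  exact ⟨((ω.1 t).1.1, (ω.1 t).1.2.toNat.size), ⟨t, ht, rfl, rfl⟩, ω.1 t, rfl, rfl, ht.symm⟩

end Transience

end CombCollision


theorem mainTheorem1 (α : ℝ) :
    (α ≤ 1 → CombCollision.InfiniteCollisionProperty
      (CombCollision.wedgeComb (CombCollision.powerProfile α))) ∧
    (1 < α → CombCollision.FiniteCollisionProperty
      (CombCollision.wedgeComb (CombCollision.powerProfile α))) :=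
  ⟨CombCollision.infiniteCollisionProperty_of_le_one,
    CombCollision.finiteCollisionProperty_of_one_lt⟩
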